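/- Let $M$ be a smooth manifold of dimension $2m+1$ with an almost contact metric structure $(\vec\xi,\eta,\varphi,g)$: $\vec\xi$ is a vector field, $\eta$ a 1-form, $\varphi$ an endomorphism field and $g$ a (pseudo-)Riemannian metric, all smooth, with $\varphi^2=-I+\eta\otimes\vec\xi$, $\eta(\vec\xi)=1$ and $g(\varphi X,\varphi Y)=g(X,Y)-\eta(X)\eta(Y)$. Put $D=\ker\eta$, $Q=\eta\otimes\vec\xi$, $P=I-Q$, $\Omega(X,Y)=g(X,\varphi Y)$ and $\omega=d\eta$, with the normalization $2\,d\eta(X,Y)=X\eta(Y)-Y\eta(X)-\eta([X,Y])$; let $\psi$ and $C$ be the endomorphisms with $g(\psi X,Y)=\omega(X,Y)$ and $g(CX,Y)=\frac12(L_{\vec\xi}\,g)(X,Y)$. Assume that the structure is almost quasi-Sasakian: $d\Omega=0$, $N_\varphi+2\varphi^*d\eta\otimes\vec\xi=0$ and $d\eta(\vec\xi,\cdot)=0$, where $N_\varphi(X,Y)=[\varphi X,\varphi Y]+\varphi^2[X,Y]-\varphi[\varphi X,Y]-\varphi[X,\varphi Y]$. With $\widetilde\nabla$ the Levi-Civita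 connection of $g$ and $N=2\psi$, the canonical connection is $$\nabla^N_XY=\widetilde\nabla_XY+(\widetilde\nabla_X\eta)(Y)\vec\xi-\eta(Y)\widetilde\nabla_X\vec\xi-\eta(X)(\widetilde\nabla_{\vec\xi}\,\eta)(Y)\vec\xi-\eta(X)(C+\psi-N)Y .$$ Let $K(X,Y)Z=\nabla^N_X\nabla^N_YZ-\nabla^N_Y\nabla^N_XZ-\nabla^N_{[X,Y]}Z$ be its curvature, $k(X,Z)=\mathrm{tr}(Y\mapsto K(X,Y)Z)$ its Ricci tensor, $S$ its torsion and $\tilde S(X,Y,Z)=g(S(X,Y),Z)$. Call $M$ Einstein with respect to $\nabla^N$ if $k=\lambda g$ for some constant $\lambda$. For sections $X,Y,Z$ of $D$ let $\nabla_XY=P\widetilde\nabla_XY$, let $$R(X,Y)Z=\nabla_X\nabla_YZ-\nabla_Y\nabla_XZ-\nabla_{P[X,Y]}Z-P[Q[X,Y],Z]$$ be the Schouten curvature tensor and let $r(X,Z)=\mathrm{tr}(Y\mapsto R(X,Y)Z)$ (trace over $D$) be the Ricci–Wagner tensor. A chart $(x^1,\dots,x^{2m},x^n)$, $n=2m+1$,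 is adapted if $\partial_n=\vec\xi$; components with indices $a,b,d\in\{1,\dots,2m\}$ refer to the frame $\vec e_a=P\partial_a$ of $D$ and the index $n$ refers to $\partial_n=\vec\xi$; $(g^{ab})$ is the inverse of the matrix $g_{ab}=g(\vec e_a,\vec e_b)$, and $\psi^b_a=g^{bd}\omega_{ad}$. Then the torsion of $\nabla^N$ is parallel ($\nabla^N\tilde S=0$) if and only if $\nabla\omega=0$. If it is parallel, then: 1. for sections $X,Z$ of $D$ one has $k(X,Z)=r(X,Z)+4\omega(X,\psi Z)$, and $k(X,\vec\xi)=k(\vec\xi,X)=0$ for all vector fields $X$; that is, $k_{ab}=r_{ab}+4\omega_{ad}\psi^d_b$ and $k_{an}=k_{na}=k_{nn}=0$ in every adapted chart; 2. $M$ is Einstein with respect to $\nabla^N$ if and only if $r(X,Z)=4\omega(\psi Z,X)$ for all sections $X,Z$ of $D$; equivalently, for any atlas of adapted charts, if and only if $r_{ab}=4\omega_{da}\psi^d_b$ in all charts of the atlas. -/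

import Mathlib

open Set Filter Topology Bundle VectorField
open scoped Manifold ContDiff

noncomputable section

/-- The model space `ℝ^(2m+1)` with its Euclidean norm. -/
abbrev Model (m : ℕ) : Type := EuclideanSpace ℝ (Fin (2 * m + 1))

/-- Vector fields on `M`, without regularity; regularity is always stated separately. -/
abbrev VF (m : ℕ) (M : Type*) [TopologicalSpace M] [ChartedSpace (Model m) M] : Type _ :=
  (p : M) → TangentSpace (𝓡 (2 * m + 1)) p

section Basics

variable {m : ℕ} {M : Type*} [TopologicalSpace M] [ChartedSpace (Model m) M]
  [IsManifold (𝓡 (2 * m + 1)) ∞ M]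

/-- `X` is a vector field that is smooth at `p`. -/
def SmoothAt (X : VF m M) (p : M) : Prop :=
  ContMDiffAt (𝓡 (2 * m + 1)) ((𝓡 (2 * m + 1)).prod 𝓘(ℝ, Model m)) ∞
    (fun q ↦ TotalSpace.mk' (Model m) q (X q)) p

/-- The derivative `(X f)(p)` of a function along a vector field. -/
def dirDeriv (X : VF m M) (f : M → ℝ) (p : M) : ℝ :=
  mvfderiv (𝓡 (2 * m + 1)) f p (X p)

/-- The Lie bracket `[X, Y]`. -/
def bracket (X Y : VF m M) : VF m M := mlieBracket (𝓡 (2 * m + 1)) X Y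

/-- The standard basis of `T_p M`, which is `ℝ^(2m+1)` through the preferred chart at `p`. -/
def stdBasis (p : M) : Module.Basis (Fin (2 * m + 1)) ℝ (TangentSpace (𝓡 (2 * m + 1)) p) :=
  (EuclideanSpace.basisFun (Fin (2 * m + 1)) ℝ).toBasis

/-- A local frame around `p`: the `i`-th field is the extension of the `i`-th basis vector of
`T_p M` that is constant in the preferred trivialization at `p`. -/
def localFrame (p : M) (i : Fin (2 * m + 1)) : VF m M :=
  FiberBundle.extend (Model m) (stdBasis p i)

/-- The trace at `p` of the endomorphism of `T_p M` induced by an operator `T` on vector fields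
that is linear over functions. -/
def traceAt (T : VF m M → VF m M) (p : M) : ℝ :=
  ∑ i, (stdBasis p).repr (T (localFrame p i) p) i

end Basics

/-- An almost contact metric structure `(ξ, η, φ, g)` on a smooth manifold `M` of dimension
`2m+1`; the metric `g` is allowed to be pseudo-Riemannian. -/
structure AlmostContactMetric (m : ℕ) (M : Type*) [TopologicalSpace M]
    [ChartedSpace (Model m) M] [IsManifold (𝓡 (2 * m + 1)) ∞ M] where
  ξ : VF m M
  η : (p : M) → TangentSpace (𝓡 (2 * m + 1)) p →L[ℝ] ℝ
  φ : (p : M) → TangentSpace (𝓡 (2 * m + 1)) p →L[ℝ] TangentSpace (𝓡 (2 * m + 1)) p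
  g : (p : M) → TangentSpace (𝓡 (2 * m + 1)) p →L[ℝ] TangentSpace (𝓡 (2 * m + 1)) p →L[ℝ] ℝ
  smooth_ξ : ContMDiff (𝓡 (2 * m + 1)) ((𝓡 (2 * m + 1)).prod 𝓘(ℝ, Model m)) ∞
    (fun p ↦ TotalSpace.mk' (Model m) p (ξ p))
  smooth_η : ContMDiff (𝓡 (2 * m + 1)) ((𝓡 (2 * m + 1)).prod 𝓘(ℝ, Model m →L[ℝ] ℝ)) ∞
    (fun p ↦ TotalSpace.mk' (Model m →L[ℝ] ℝ)
      (E := fun q : M ↦ TangentSpace (𝓡 (2 * m + 1)) q →L[ℝ] ℝ) p (η p))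
  smooth_φ : ContMDiff (𝓡 (2 * m + 1)) ((𝓡 (2 * m + 1)).prod 𝓘(ℝ, Model m →L[ℝ] Model m)) ∞
    (fun p ↦ TotalSpace.mk' (Model m →L[ℝ] Model m)
      (E := fun q : M ↦ TangentSpace (𝓡 (2 * m + 1)) q →L[ℝ] TangentSpace (𝓡 (2 * m + 1)) q)
      p (φ p))
  smooth_g : ContMDiff (𝓡 (2 * m + 1)) ((𝓡 (2 * m + 1)).prod 𝓘(ℝ, Model m →L[ℝ] Model m →L[ℝ] ℝ)) ∞
    (fun p ↦ TotalSpace.mk' (Model m →L[ℝ] Model m →L[ℝ] ℝ)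
      (E := fun q : M ↦
        TangentSpace (𝓡 (2 * m + 1)) q →L[ℝ] TangentSpace (𝓡 (2 * m + 1)) q →L[ℝ] ℝ)
      p (g p))
  g_symm : ∀ p u v, g p u v = g p v u
  g_nondegenerate : ∀ p u, (∀ v, g p u v = 0) → u = 0
  φ_sq : ∀ p u, φ p (φ p u) = -u + η p u • ξ p
  η_ξ : ∀ p, η p (ξ p) = 1
  g_φ : ∀ p u v, g p (φ p u) (φ p v) = g p u v - η p u * η p v

namespace AlmostContactMetric

variable {m : ℕ} {M : Type*} [TopologicalSpace M] [ChartedSpace (Model m) M]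
  [IsManifold (𝓡 (2 * m + 1)) ∞ M] (A : AlmostContactMetric m M)

/-- The function `η(X)`. -/
def eta (X : VF m M) (p : M) : ℝ := A.η p (X p)

/-- The function `g(X, Y)`. -/
def metric (X Y : VF m M) (p : M) : ℝ := A.g p (X p) (Y p)

/-- The vector field `φ X`. -/
def phi (X : VF m M) : VF m M := fun p ↦ A.φ p (X p)

/-- The projection `Q X = η(X) ξ` onto the orthogonal complement of `D = ker η`. -/
def projQ (X : VF m M) : VF m M := fun p ↦ A.η p (X p) • A.ξ p

/-- The projection `P = 1 - Q` onto `D = ker η`. -/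
def projP (X : VF m M) : VF m M := fun p ↦ X p - A.η p (X p) • A.ξ p

/-- Near `p`, the vector field `X` is a smooth section of the distribution `D = ker η`. -/
def AdmissibleAt (X : VF m M) (p : M) : Prop :=
  SmoothAt X p ∧ ∀ᶠ q in 𝓝 p, A.η q (X q) = 0

/-- `ω = dη`, with the normalization
`2 dη(X, Y) = X η(Y) - Y η(X) - η([X, Y])`. -/
def omega (X Y : VF m M) (p : M) : ℝ :=
  (1 / 2) * (dirDeriv X (A.eta Y) p - dirDeriv Y (A.eta X) p - A.eta (bracket X Y) p)

/-- The fundamental form `Ω(X, Y) = g(X, φ Y)`. -/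
def fundForm (X Y : VF m M) (p : M) : ℝ := A.metric X (A.phi Y) p

/-- `dΩ`, with the normalization that goes with the one of `dη`. -/
def dFundForm (X Y Z : VF m M) (p : M) : ℝ :=
  (1 / 3) * (dirDeriv X (A.fundForm Y Z) p + dirDeriv Y (A.fundForm Z X) p
    + dirDeriv Z (A.fundForm X Y) p - A.fundForm (bracket X Y) Z p
    - A.fundForm (bracket Y Z) X p - A.fundForm (bracket Z X) Y p)

/-- The Nijenhuis tensor of `φ`. -/
def nijenhuis (X Y : VF m M) : VF m M := fun p ↦
  bracket (A.phi X) (A.phi Y) p + A.phi (A.phi (bracket X Y)) p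
    - A.phi (bracket (A.phi X) Y) p - A.phi (bracket X (A.phi Y)) p

/-- Almost quasi-Sasakian structures: `dΩ = 0`, `N_φ + 2 φ^*dη ⊗ ξ = 0` and `dη(ξ, ·) = 0`. -/
structure IsAlmostQuasiSasakian : Prop where
  closed : ∀ p X Y Z, SmoothAt X p → SmoothAt Y p → SmoothAt Z p → A.dFundForm X Y Z p = 0
  almostNormal : ∀ p X Y, SmoothAt X p → SmoothAt Y p →
    A.nijenhuis X Y p + (2 * A.omega (A.phi X) (A.phi Y) p) • A.ξ p = 0
  omega_ξ : ∀ p X, SmoothAt X p → A.omega A.ξ X p = 0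

/-- The Gram matrix of `g` at `p` in the frame `localFrame p`. -/
def gram (p : M) : Matrix (Fin (2 * m + 1)) (Fin (2 * m + 1)) ℝ :=
  Matrix.of fun i j ↦ A.metric (localFrame p i) (localFrame p j) p

/-- Raising an index: the vector `w` of `T_p M` with `g(w, Z(p)) = α(Z)(p)` for the 1-form `α`
(given as an operation on vector fields that is linear over functions). -/
def sharp (α : VF m M → M → ℝ) : VF m M := fun p ↦
  ∑ i, (∑ j, (A.gram p)⁻¹ i j * α (localFrame p j) p) • stdBasis p i

/-- The Levi-Civita connection `∇̃_X Y` of `g`, given by the Koszul formula. -/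
def leviCivita (X Y : VF m M) : VF m M :=
  A.sharp fun Z p ↦ (1 / 2) *
    (dirDeriv X (A.metric Y Z) p + dirDeriv Y (A.metric X Z) p - dirDeriv Z (A.metric X Y) p
      + A.metric (bracket X Y) Z p - A.metric (bracket X Z) Y p - A.metric (bracket Y Z) X p)

/-- The endomorphism `ψ` with `g(ψ X, Y) = ω(X, Y)`. -/
def psi (X : VF m M) : VF m M := A.sharp fun Y ↦ A.omega X Y

/-- The endomorphism `C` with `g(C X, Y) = (1/2) (L_ξ g)(X, Y)`. -/
def endoC (X : VF m M) : VF m M :=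
  A.sharp fun Y p ↦ (1 / 2) * (dirDeriv A.ξ (A.metric X Y) p
    - A.metric (bracket A.ξ X) Y p - A.metric X (bracket A.ξ Y) p)

/-- `(∇̃_X η)(Y)`. -/
def covEta (X Y : VF m M) (p : M) : ℝ :=
  dirDeriv X (A.eta Y) p - A.eta (A.leviCivita X Y) p

/-- The `N`-connection
`∇^N_X Y = ∇̃_X Y + (∇̃_X η)(Y) ξ - η(Y) ∇̃_X ξ - η(X) (∇̃_ξ η)(Y) ξ - η(X) (C + ψ - N) Y`. -/
def nConnection (N : VF m M → VF m M) (X Y : VF m M) : VF m M := fun p ↦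
  A.leviCivita X Y p + A.covEta X Y p • A.ξ p - A.eta Y p • A.leviCivita X A.ξ p
    - (A.eta X p * A.covEta A.ξ Y p) • A.ξ p
    - A.eta X p • (A.endoC Y p + A.psi Y p - N Y p)

/-- The canonical connection: the `N`-connection with `N = 2ψ`. -/
def canonical (X Y : VF m M) : VF m M := A.nConnection (fun Z p ↦ (2 : ℝ) • A.psi Z p) X Y

/-- The torsion `S(X, Y)` of the canonical connection. -/
def torsion (X Y : VF m M) : VF m M := fun p ↦
  A.canonical X Y p - A.canonical Y X p - bracket X Y p

/-- The torsion as a tensor of type `(0, 3)`: `g(S(X, Y), Z)`. -/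
def torsion3 (X Y Z : VF m M) (p : M) : ℝ := A.metric (A.torsion X Y) Z p

/-- The torsion of the canonical connection is parallel with respect to that connection. -/
def HasParallelTorsion : Prop :=
  ∀ p W X Y Z, SmoothAt W p → SmoothAt X p → SmoothAt Y p → SmoothAt Z p →
    dirDeriv W (A.torsion3 X Y Z) p - A.torsion3 (A.canonical W X) Y Z p
      - A.torsion3 X (A.canonical W Y) Z p - A.torsion3 X Y (A.canonical W Z) p = 0

/-- The curvature `K(X, Y)Z` of the canonical connection. -/
def curvature (X Y Z : VF m M) : VF m M := fun p ↦
  A.canonical X (A.canonical Y Z) p - A.canonical Y (A.canonical X Z) p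
    - A.canonical (bracket X Y) Z p

/-- The Ricci tensor of the canonical connection, `k(X, Z) = tr (Y ↦ K(X, Y)Z)`. -/
def ricci (X Z : VF m M) (p : M) : ℝ := traceAt (fun Y ↦ A.curvature X Y Z) p

/-- `M` is Einstein with respect to the canonical connection. -/
def IsEinstein : Prop :=
  ∃ c : ℝ, ∀ p X Z, SmoothAt X p → SmoothAt Z p → A.ricci X Z p = c * A.metric X Z p

/-- The interior metric connection `∇_X Y = P ∇̃_X Y` (for `X`, `Y` sections of `D`). -/
def interior (X Y : VF m M) : VF m M := A.projP (A.leviCivita X Y)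

/-- `∇ω = 0` for the interior connection `∇`. -/
def IsOmegaParallel : Prop :=
  ∀ p X Y Z, A.AdmissibleAt X p → A.AdmissibleAt Y p → A.AdmissibleAt Z p →
    dirDeriv X (A.omega Y Z) p - A.omega (A.interior X Y) Z p - A.omega Y (A.interior X Z) p = 0

/-- The Schouten curvature tensor
`R(X, Y)Z = ∇_X ∇_Y Z - ∇_Y ∇_X Z - ∇_{P[X, Y]} Z - P[Q[X, Y], Z]` of the distribution `D`. -/
def schouten (X Y Z : VF m M) : VF m M := fun p ↦
  A.interior X (A.interior Y Z) p - A.interior Y (A.interior X Z) p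
    - A.interior (A.projP (bracket X Y)) Z p
    - A.projP (bracket (A.projQ (bracket X Y)) Z) p

/-- The Ricci-Wagner tensor `r(X, Z) = tr (Y ↦ R(X, Y)Z)`, for `X`, `Z` sections of `D`. The trace
is the one of an endomorphism of `D_p`; it is computed as the trace of the extension of that
endomorphism to `T_p M` by zero on `ξ`. -/
def ricciWagner (X Z : VF m M) (p : M) : ℝ :=
  traceAt (fun Y ↦ A.schouten X (A.projP Y) Z) p

/-- The coordinate vector field `∂_i` of a chart. -/
def coordField (c : OpenPartialHomeomorph M (Model m)) (i : Fin (2 * m + 1)) : VF m M :=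
  mpullback (𝓡 (2 * m + 1)) 𝓘(ℝ, Model m) c fun _ ↦ EuclideanSpace.single i (1 : ℝ)

/-- A chart of the smooth structure is adapted to `D` if its last coordinate field is `ξ`. -/
def IsAdapted (c : OpenPartialHomeomorph M (Model m)) : Prop :=
  c ∈ IsManifold.maximalAtlas (𝓡 (2 * m + 1)) ∞ M ∧
    ∀ p ∈ c.source, coordField c (Fin.last (2 * m)) p = A.ξ p

/-- The fields `e_a = P(∂_a)`, `a = 1, …, 2m`, of an adapted chart, which span `D`. -/
def adaptedFrame (c : OpenPartialHomeomorph M (Model m)) (a : Fin (2 * m)) : VF m M :=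
  A.projP (coordField c a.castSucc)

/-- The components `ω_ab` in an adapted chart. -/
def omegaComp (c : OpenPartialHomeomorph M (Model m)) (p : M) (a b : Fin (2 * m)) : ℝ :=
  A.omega (A.adaptedFrame c a) (A.adaptedFrame c b) p

/-- The components `ψ^b_a = g^{bd} ω_ad` in an adapted chart, where `(g^{ab})` is the inverse of
the matrix `g_ab = g(e_a, e_b)`. -/
def psiComp (c : OpenPartialHomeomorph M (Model m)) (p : M) (b a : Fin (2 * m)) : ℝ :=
  ∑ d, (Matrix.of fun a' b' ↦ A.metric (A.adaptedFrame c a') (A.adaptedFrame c b') p)⁻¹ b d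
    * A.omegaComp c p a d

/-- The components `r_ab` of the Ricci-Wagner tensor in an adapted chart. -/
def ricciWagnerComp (c : OpenPartialHomeomorph M (Model m)) (p : M) (a b : Fin (2 * m)) : ℝ :=
  A.ricciWagner (A.adaptedFrame c a) (A.adaptedFrame c b) p

end AlmostContactMetric

end

/-! The heart of the matter is that `ξ` is a Killing field. The condition `dη(ξ, ·) = 0` says `L_ξ η
= 0`, almost normality on `(ξ, X)` gives `L_ξ φ = 0`, and `dΩ = 0` gives `L_ξ Ω = 0`; together `L_ξ
g = 0` (`lieMetric_eq_zero`). Hence `C = 0` and `∇̃_X ξ = ψX`, and the canonical connection becomes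
`∇̃_X Y + ω(X, Y)ξ - η(Y)ψX + η(X)ψY` (`canonical_eq`). It preserves `g`, `η` and `ξ`, satisfies
`∇^N_ξ = L_ξ + 2ψ`, restricts on `D` to the interior connection, and has a totally skew torsion
built from `η` and `ω` alone.

Since `η` is parallel, `∇^N S̃ = 0` means `∇^N ω = 0`. The derivative in the direction `ξ` vanishes
anyway, because `L_ξ ω = 0` and the contributions of `2ψ` cancel; what remains is `∇ω = 0` on `D`
(`hasParallelTorsion_iff`).

If the torsion is parallel, so is `ψ`, and `K(ξ, Y)Z` is symmetric in `Y, Z` on `D`. Metricity makes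
`g(K(ξ, Y)Z, W)` skew in `Z, W`, and a trilinear form with both symmetries is zero
(`curvature_ξ_left_admissible`). On `D` the tensors `K` and `R` differ only through the `ξ`-part of
`[X, Y]`, along which one uses `L_ξ + 2ψ` and the other `L_ξ`. The difference is `4ω(X, Y)ψZ`
(`curvature_eq_schouten`), whose trace over `Y` is `4ω(X, ψZ)`. Finally `k(ξ, ξ) = 0` and `g(ξ, ξ) =
1` force the Einstein constant to be zero.

Identities of tangent vectors are proved by pairing with smooth fields and using that `g` is
nondegenerate. -/

noncomputable section

set_option linter.unusedSectionVars false

/-! ### Pointwise calculus of functions, vector fields and Lie brackets. -/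

section Calculus

variable {m : ℕ} {M : Type*} [TopologicalSpace M] [ChartedSpace (Model m) M]
  [IsManifold (𝓡 (2 * m + 1)) ∞ M]

/-- `X` is a vector field that is differentiable at `p`. -/
def DiffVF (X : VF m M) (p : M) : Prop :=
  MDifferentiableAt (𝓡 (2 * m + 1)) ((𝓡 (2 * m + 1)).prod 𝓘(ℝ, Model m))
    (fun q ↦ TotalSpace.mk' (Model m) q (X q)) p

/-- `f` is a function that is differentiable at `p`. -/
def DiffFun (m : ℕ) {M : Type*} [TopologicalSpace M] [ChartedSpace (Model m) M]
    (f : M → ℝ) (p : M) : Prop :=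
  MDifferentiableAt (𝓡 (2 * m + 1)) 𝓘(ℝ, ℝ) f p

/-- `f` is a function that is smooth at `p`. -/
def SmoothFun (m : ℕ) {M : Type*} [TopologicalSpace M] [ChartedSpace (Model m) M]
    (f : M → ℝ) (p : M) : Prop :=
  ContMDiffAt (𝓡 (2 * m + 1)) 𝓘(ℝ, ℝ) ∞ f p

variable {X Y Z X' Y' : VF m M} {f h : M → ℝ} {p : M}

theorem natCast_le_infty (k : ℕ) : (k : WithTop ℕ∞) ≤ ∞ := by exact_mod_cast le_top

theorem isManifold_of_smooth (k : ℕ) : IsManifold (𝓡 (2 * m + 1)) (k : WithTop ℕ∞) M :=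
  IsManifold.of_le (natCast_le_infty k)

/-! ### Regularity -/

theorem SmoothAt.diff (hX : SmoothAt X p) : DiffVF X p :=
  ContMDiffAt.mdifferentiableAt hX (by simp)

theorem SmoothFun.diff (hf : SmoothFun m f p) : DiffFun m f p :=
  ContMDiffAt.mdifferentiableAt hf (by simp)

/-- Lets identities that need only differentiability hold near `p`, so that they can be
differentiated again. The passage through `C^1` matters: `C^∞` at a point gives, for each finite
order, a neighbourhood that may depend on the order. -/
theorem SmoothAt.eventually_diff (hX : SmoothAt X p) : ∀ᶠ q in 𝓝 p, DiffVF X q := by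
  have h1 : ContMDiffAt (𝓡 (2 * m + 1)) ((𝓡 (2 * m + 1)).prod 𝓘(ℝ, Model m)) 1
      (fun q ↦ TotalSpace.mk' (Model m) q (X q)) p := ContMDiffAt.of_le hX (by simp)
  have := isManifold_of_smooth (m := m) (M := M) 1
  filter_upwards [(contMDiffAt_iff_contMDiffAt_nhds (by simp)).1 h1] with q hq
  exact hq.mdifferentiableAt (by simp)

theorem SmoothFun.eventually_diff (hf : SmoothFun m f p) : ∀ᶠ q in 𝓝 p, DiffFun m f q := by
  have h1 : ContMDiffAt (𝓡 (2 * m + 1)) 𝓘(ℝ, ℝ) 1 f p := ContMDiffAt.of_le hf (by simp)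
  have := isManifold_of_smooth (m := m) (M := M) 1
  filter_upwards [(contMDiffAt_iff_contMDiffAt_nhds (by simp)).1 h1] with q hq
  exact hq.mdifferentiableAt (by simp)

theorem SmoothAt.add (hX : SmoothAt X p) (hY : SmoothAt Y p) : SmoothAt (X + Y) p :=
  ContMDiffAt.add_section hX hY

theorem SmoothAt.sub (hX : SmoothAt X p) (hY : SmoothAt Y p) : SmoothAt (X - Y) p :=
  ContMDiffAt.sub_section hX hY

theorem SmoothAt.smul (hf : SmoothFun m f p) (hX : SmoothAt X p) : SmoothAt (f • X) p :=
  ContMDiffAt.smul_section hf hX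

theorem SmoothAt.congr (hX : SmoothAt X p) (h : ∀ᶠ q in 𝓝 p, Y q = X q) : SmoothAt Y p :=
  ContMDiffAt.congr_of_eventuallyEq hX (h.mono fun q hq ↦ by simp only [hq])

theorem SmoothAt.bracket (hX : SmoothAt X p) (hY : SmoothAt Y p) : SmoothAt (bracket X Y) p := by
  have : IsManifold (𝓡 (2 * m + 1)) (((⊤ : ℕ∞) : WithTop ℕ∞) + 1) M := by
    simpa using! (inferInstance : IsManifold (𝓡 (2 * m + 1)) ∞ M)
  have h2 := isManifold_of_smooth (m := m) (M := M) 2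
  have : IsManifold (𝓡 (2 * m + 1)) (minSmoothness ℝ 2) M := by simpa using! h2
  have h3 := isManifold_of_smooth (m := m) (M := M) 3
  have : IsManifold (𝓡 (2 * m + 1)) (minSmoothness ℝ 3) M := by simpa using! h3
  exact ContMDiffAt.mlieBracket_vectorField (n := ⊤) (m := ⊤) hX hY (by simp)

theorem DiffVF.add (hX : DiffVF X p) (hY : DiffVF Y p) : DiffVF (X + Y) p :=
  mdifferentiableAt_add_section hX hY

theorem DiffVF.sub (hX : DiffVF X p) (hY : DiffVF Y p) : DiffVF (X - Y) p :=
  mdifferentiableAt_sub_section hX hY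

theorem DiffVF.smul (hf : DiffFun m f p) (hX : DiffVF X p) : DiffVF (f • X) p :=
  MDifferentiableAt.smul_section hf hX

theorem SmoothFun.add (hf : SmoothFun m f p) (hh : SmoothFun m h p) : SmoothFun m (f + h) p :=
  ContMDiffAt.add hf hh

theorem SmoothFun.sub (hf : SmoothFun m f p) (hh : SmoothFun m h p) : SmoothFun m (f - h) p :=
  ContMDiffAt.sub hf hh

theorem SmoothFun.mul (hf : SmoothFun m f p) (hh : SmoothFun m h p) : SmoothFun m (f * h) p :=
  ContMDiffAt.mul hf hh

theorem SmoothFun.congr (hf : SmoothFun m f p) (hh : ∀ᶠ q in 𝓝 p, h q = f q) :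
    SmoothFun m h p :=
  ContMDiffAt.congr_of_eventuallyEq hf hh

theorem smoothFun_const (c : ℝ) : SmoothFun m (fun _ : M ↦ c) p := contMDiffAt_const

theorem diffFun_const (c : ℝ) : DiffFun m (fun _ : M ↦ c) p := (smoothFun_const c).diff

theorem DiffFun.add (hf : DiffFun m f p) (hh : DiffFun m h p) : DiffFun m (f + h) p :=
  MDifferentiableAt.add hf hh

theorem DiffFun.sub (hf : DiffFun m f p) (hh : DiffFun m h p) : DiffFun m (f - h) p :=
  MDifferentiableAt.sub hf hh

theorem DiffFun.mul (hf : DiffFun m f p) (hh : DiffFun m h p) : DiffFun m (f * h) p :=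
  MDifferentiableAt.mul hf hh

/-- The extension of a tangent vector at `p` to a vector field. -/
def extendVF {p : M} (v : TangentSpace (𝓡 (2 * m + 1)) p) : VF m M :=
  FiberBundle.extend (Model m) v

@[simp] theorem extendVF_self (v : TangentSpace (𝓡 (2 * m + 1)) p) : extendVF v p = v :=
  FiberBundle.extend_apply_self _ v

theorem smoothAt_extendVF (v : TangentSpace (𝓡 (2 * m + 1)) p) : SmoothAt (extendVF v) p :=
  FiberBundle.contMDiffAt_extend _ _ v

theorem diffVF_extendVF (v : TangentSpace (𝓡 (2 * m + 1)) p) : DiffVF (extendVF v) p :=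
  (smoothAt_extendVF v).diff

theorem smoothAt_localFrame (p : M) (i : Fin (2 * m + 1)) : SmoothAt (localFrame p i) p :=
  smoothAt_extendVF _

@[simp] theorem localFrame_self (p : M) (i : Fin (2 * m + 1)) :
    localFrame p i p = stdBasis p i :=
  extendVF_self _

/-! ### Derivatives of functions along vector fields -/

theorem dirDeriv_congr (hf : ∀ᶠ q in 𝓝 p, f q = h q) : dirDeriv X f p = dirDeriv X h p := by
  have : f =ᶠ[𝓝 p] h := hf
  rw [dirDeriv, dirDeriv, mvfderiv, mvfderiv, this.mfderiv_eq, this.eq_of_nhds]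

theorem dirDeriv_add (hf : DiffFun m f p) (hh : DiffFun m h p) :
    dirDeriv X (f + h) p = dirDeriv X f p + dirDeriv X h p := by
  simp only [dirDeriv, mvfderiv_add hf hh]; rfl

theorem dirDeriv_sub (hf : DiffFun m f p) (hh : DiffFun m h p) :
    dirDeriv X (f - h) p = dirDeriv X f p - dirDeriv X h p := by
  simp only [dirDeriv, mvfderiv_sub hf hh]; rfl

theorem dirDeriv_mul (hf : DiffFun m f p) (hh : DiffFun m h p) :
    dirDeriv X (f * h) p = f p * dirDeriv X h p + h p * dirDeriv X f p := by
  simp only [dirDeriv, mvfderiv_mul hf hh]; rfl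

@[simp] theorem dirDeriv_const (c : ℝ) : dirDeriv X (fun _ ↦ c) p = 0 := by
  simp only [dirDeriv, mvfderiv_const]; rfl

theorem dirDeriv_add_left : dirDeriv (X + Y) f p = dirDeriv X f p + dirDeriv Y f p :=
  map_add (mvfderiv (𝓡 (2 * m + 1)) f p) (X p) (Y p)

theorem dirDeriv_smul_left : dirDeriv (h • X) f p = h p * dirDeriv X f p :=
  map_smul (mvfderiv (𝓡 (2 * m + 1)) f p) (h p) (X p)

theorem dirDeriv_congr_left (hXY : X p = Y p) : dirDeriv X f p = dirDeriv Y f p := by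
  simp only [dirDeriv, hXY]

/-! ### Lie brackets -/

theorem bracket_swap : bracket X Y p = -bracket Y X p :=
  mlieBracket_swap_apply

theorem bracket_congr (hX : ∀ᶠ q in 𝓝 p, X q = X' q) (hY : ∀ᶠ q in 𝓝 p, Y q = Y' q) :
    bracket X Y p = bracket X' Y' p :=
  Filter.EventuallyEq.mlieBracket_vectorField_eq hX hY

theorem bracket_add_right (hY : DiffVF Y p) (hZ : DiffVF Z p) :
    bracket X (Y + Z) p = bracket X Y p + bracket X Z p := by
  have := isManifold_of_smooth (m := m) (M := M) 2
  exact mlieBracket_add_right hY hZ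

theorem bracket_smul_right (hf : DiffFun m f p) (hY : DiffVF Y p) :
    bracket X (f • Y) p = dirDeriv X f p • Y p + f p • bracket X Y p := by
  have := isManifold_of_smooth (m := m) (M := M) 2
  exact mlieBracket_smul_right hf hY

theorem bracket_add_left (hX : DiffVF X p) (hY : DiffVF Y p) :
    bracket (X + Y) Z p = bracket X Z p + bracket Y Z p := by
  rw [bracket_swap, bracket_add_right hX hY, neg_add, ← bracket_swap, ← bracket_swap]

theorem bracket_smul_left (hf : DiffFun m f p) (hX : DiffVF X p) :
    bracket (f • X) Y p = -(dirDeriv Y f p • X p) + f p • bracket X Y p := by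
  rw [bracket_swap, bracket_smul_right hf hX, neg_add, bracket_swap (X := X), smul_neg]

@[simp] theorem bracket_zero_left : bracket 0 X p = 0 := by
  simp [bracket]

@[simp] theorem bracket_self : bracket X X p = 0 := by
  simp [bracket]

theorem bracket_jacobi (hX : SmoothAt X p) (hY : SmoothAt Y p) (hZ : SmoothAt Z p) :
    bracket X (bracket Y Z) p = bracket (bracket X Y) Z p + bracket Y (bracket X Z) p := by
  have := isManifold_of_smooth (m := m) (M := M) 3
  have : IsManifold (𝓡 (2 * m + 1)) (minSmoothness ℝ 3) M := by simpa using this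
  have hk {W : VF m M} (hW : SmoothAt W p) :
      ContMDiffAt (𝓡 (2 * m + 1)) ((𝓡 (2 * m + 1)).prod 𝓘(ℝ, Model m)) (minSmoothness ℝ 2)
      (fun q ↦ TotalSpace.mk' (Model m) q (W q)) p :=
    ContMDiffAt.of_le hW (by simpa using! natCast_le_infty 2)
  exact leibniz_identity_mlieBracket_apply (hk hX) (hk hY) (hk hZ)

end Calculus

namespace AlmostContactMetric

variable {m : ℕ} {M : Type*} [TopologicalSpace M] [ChartedSpace (Model m) M]
  [IsManifold (𝓡 (2 * m + 1)) ∞ M] (A : AlmostContactMetric m M)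
  {X Y Z : VF m M} {f : M → ℝ} {p : M}

/-! ### Algebra of the structure tensors -/

theorem metric_symm : A.metric X Y = A.metric Y X := funext fun q ↦ A.g_symm q _ _

theorem metric_add_left : A.metric (X + Y) Z = A.metric X Z + A.metric Y Z := by
  ext q; simp [metric]

theorem metric_smul_left : A.metric (f • X) Y = f * A.metric X Y := by
  ext q; simp [metric]

theorem metric_add_right : A.metric X (Y + Z) = A.metric X Y + A.metric X Z := by
  ext q; simp [metric]

theorem metric_smul_right : A.metric X (f • Y) = f * A.metric X Y := by
  ext q; simp [metric]

theorem eta_add : A.eta (X + Y) = A.eta X + A.eta Y := by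
  ext q; simp [eta]

theorem eta_smul : A.eta (f • X) = f * A.eta X := by
  ext q; simp [eta]

theorem phi_ξ (p : M) : A.φ p (A.ξ p) = 0 := by
  have h1 : A.φ p (A.φ p (A.ξ p)) = 0 := by rw [A.φ_sq, A.η_ξ]; simp
  -- Applying `φ² = -1 + η ⊗ ξ` to `φξ`, with `φ²ξ = 0`, gives `φξ = aξ`; then `a²ξ = φ²ξ = 0`.
  have h2 := A.φ_sq p (A.φ p (A.ξ p))
  rw [h1, map_zero] at h2
  have h3 : A.φ p (A.ξ p) = A.η p (A.φ p (A.ξ p)) • A.ξ p :=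
    neg_add_eq_zero.1 h2.symm
  set a := A.η p (A.φ p (A.ξ p))
  have h4 : (a * a) • A.ξ p = 0 := by
    rw [mul_smul, ← h3, ← map_smul, ← h3, h1]
  have h5 : a * a = 0 := by simpa [A.η_ξ] using congrArg (A.η p) h4
  rw [h3, mul_self_eq_zero.1 h5, zero_smul]

theorem g_ξ_right (p : M) (v : TangentSpace (𝓡 (2 * m + 1)) p) : A.g p v (A.ξ p) = A.η p v := by
  have h := A.g_φ p v (A.ξ p)
  rw [phi_ξ, map_zero, A.η_ξ] at h
  linarith

theorem g_ξ_left (p : M) (v : TangentSpace (𝓡 (2 * m + 1)) p) : A.g p (A.ξ p) v = A.η p v := by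
  rw [A.g_symm, g_ξ_right]

theorem η_φ (p : M) (v : TangentSpace (𝓡 (2 * m + 1)) p) : A.η p (A.φ p v) = 0 := by
  have h := A.g_φ p (A.φ p v) (A.ξ p)
  rw [phi_ξ, map_zero, A.η_ξ, g_ξ_right] at h
  -- `φ³v` is computed as `φ²(φv)` and as `φ(φ²v)`; comparing the two leaves `η(φv)ξ = 0`.
  have h1 := A.φ_sq p (A.φ p v)
  have h2 : A.φ p (A.φ p (A.φ p v)) = A.φ p (-v + A.η p v • A.ξ p) := by rw [A.φ_sq p v]
  rw [h2] at h1
  simp only [map_add, map_neg, map_smul, phi_ξ, smul_zero, add_zero] at h1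
  have h3 := congrArg (A.η p) h1
  simpa [A.η_ξ] using h3

theorem g_φ_left (p : M) (u v : TangentSpace (𝓡 (2 * m + 1)) p) :
    A.g p (A.φ p u) v = -A.g p u (A.φ p v) := by
  have h := A.g_φ p u (A.φ p v)
  rw [A.φ_sq, η_φ, map_add, map_neg, map_smul, g_ξ_right, η_φ] at h
  simp at h
  linarith

/-- Every tangent vector extends to a smooth field, so smooth fields are enough test vectors for the
nondegenerate `g`. -/
theorem eq_of_g_eq {u v : TangentSpace (𝓡 (2 * m + 1)) p}
    (h : ∀ Z : VF m M, SmoothAt Z p → A.g p u (Z p) = A.g p v (Z p)) : u = v := by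
  rw [← sub_eq_zero]
  refine A.g_nondegenerate p _ fun w ↦ ?_
  have := h (extendVF w) (smoothAt_extendVF w)
  rw [extendVF_self] at this
  rw [map_sub, _root_.sub_apply, this, sub_self]

/-! ### Regularity of the structure tensors -/

theorem smoothAt_ξ (p : M) : SmoothAt A.ξ p := A.smooth_ξ p

theorem diffVF_ξ (p : M) : DiffVF A.ξ p := (A.smoothAt_ξ p).diff

theorem smoothFun_eta (hX : SmoothAt X p) : SmoothFun m (A.eta X) p := by
  have h := ContMDiffAt.clm_bundle_apply (E₂ := Bundle.Trivial M ℝ) (F₂ := ℝ) (A.smooth_η p) hX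
  exact ((contMDiffAt_section _).1 h)

theorem diffFun_eta (hX : DiffVF X p) : DiffFun m (A.eta X) p := by
  have h := MDifferentiableAt.clm_bundle_apply (E₂ := Bundle.Trivial M ℝ) (F₂ := ℝ)
    ((A.smooth_η p).mdifferentiableAt (by simp)) hX
  exact ((mdifferentiableAt_section _ _).1 h)

theorem smoothFun_metric (hX : SmoothAt X p) (hY : SmoothAt Y p) :
    SmoothFun m (A.metric X Y) p := by
  have h := ContMDiffAt.clm_bundle_apply₂ (E₃ := Bundle.Trivial M ℝ) (F₃ := ℝ)
    (A.smooth_g p) hX hY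
  exact ((contMDiffAt_section _).1 h)

theorem diffFun_metric (hX : DiffVF X p) (hY : DiffVF Y p) : DiffFun m (A.metric X Y) p := by
  have h := MDifferentiableAt.clm_bundle_apply₂ (E₃ := Bundle.Trivial M ℝ) (F₃ := ℝ)
    ((A.smooth_g p).mdifferentiableAt (by simp)) hX hY
  exact ((mdifferentiableAt_section _ _).1 h)

theorem smoothAt_phi (hX : SmoothAt X p) : SmoothAt (A.phi X) p :=
  ContMDiffAt.clm_bundle_apply (A.smooth_φ p) hX

theorem diffVF_phi (hX : DiffVF X p) : DiffVF (A.phi X) p :=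
  MDifferentiableAt.clm_bundle_apply ((A.smooth_φ p).mdifferentiableAt (by simp)) hX

theorem projQ_eq : A.projQ X = A.eta X • A.ξ := rfl

theorem smoothAt_projP (hX : SmoothAt X p) : SmoothAt (A.projP X) p :=
  hX.sub (.smul (A.smoothFun_eta hX) (A.smoothAt_ξ p))

theorem diffVF_projP (hX : DiffVF X p) : DiffVF (A.projP X) p :=
  hX.sub (.smul (A.diffFun_eta hX) (A.diffVF_ξ p))

theorem η_projP (X : VF m M) (p : M) : A.η p (A.projP X p) = 0 := by
  simp [projP, A.η_ξ]

theorem admissibleAt_projP (hX : SmoothAt X p) : A.AdmissibleAt (A.projP X) p :=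
  ⟨A.smoothAt_projP hX, .of_forall fun q ↦ A.η_projP X q⟩

/-- Derivatives of smooth functions along smooth fields are smooth. -/
theorem smoothFun_dirDeriv (A : AlmostContactMetric m M) (hX : SmoothAt X p) (hf : SmoothFun m f p) :
    SmoothFun m (dirDeriv X f) p := by
  -- Since `[X, fξ] = (Xf)ξ + f[X, ξ]` and `η(ξ) = 1`, one has `Xf = η([X, fξ]) - f η([X, ξ])`, and
  -- brackets of smooth fields are smooth.
  have h1 := A.smoothFun_eta (hX.bracket (.smul hf (A.smoothAt_ξ p)))
  have h2 := hf.mul (A.smoothFun_eta (hX.bracket (A.smoothAt_ξ p)))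
  refine (h1.sub h2).congr ?_
  filter_upwards [hf.eventually_diff] with q hq
  simp [eta, bracket_smul_right hq (A.diffVF_ξ q), A.η_ξ]

/-- `X(Y f) - Y(X f) = [X, Y] f`. -/
theorem dirDeriv_bracket (A : AlmostContactMetric m M) (hX : SmoothAt X p) (hY : SmoothAt Y p)
    (hf : SmoothFun m f p) :
    dirDeriv (bracket X Y) f p = dirDeriv X (dirDeriv Y f) p - dirDeriv Y (dirDeriv X f) p := by
  have hξ := A.smoothAt_ξ p
  have key : ∀ {V W : VF m M}, SmoothAt V p → SmoothAt W p →
      bracket V (bracket W (f • A.ξ)) p = dirDeriv V (dirDeriv W f) p • A.ξ p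
        + dirDeriv W f p • bracket V A.ξ p + (dirDeriv V f p • bracket W A.ξ p
        + f p • bracket V (bracket W A.ξ) p) := by
    intro V W hV hW
    have hd := A.smoothFun_dirDeriv hW hf
    have h1 : bracket V (bracket W (f • A.ξ)) p
        = bracket V (dirDeriv W f • A.ξ + f • bracket W A.ξ) p := by
      refine bracket_congr (.of_forall fun _ ↦ rfl) ?_
      filter_upwards [hf.eventually_diff] with q hq
      exact bracket_smul_right hq (A.diffVF_ξ q)
    rw [h1, bracket_add_right (DiffVF.smul hd.diff hξ.diff)
      (DiffVF.smul hf.diff (hW.bracket hξ).diff),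
      bracket_smul_right hd.diff hξ.diff, bracket_smul_right hf.diff (hW.bracket hξ).diff]
  -- In the Jacobi identity for `X`, `Y`, `fξ` the first-order cross terms cancel, and so do `f`
  -- times the terms of the identity for `X`, `Y`, `ξ`. The coefficient of `ξ`, read off by `η`, is
  -- the claim.
  have h := bracket_jacobi hX hY (SmoothAt.smul hf hξ)
  rw [key hX hY, key hY hX, bracket_smul_right hf.diff hξ.diff, bracket_jacobi hX hY hξ] at h
  have h2 := congrArg (A.η p) h
  simp only [map_add, map_smul, A.η_ξ, smul_eq_mul, mul_one] at h2
  linarith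

end AlmostContactMetric

/-! ### Smooth dependence of determinants and inverse matrices. -/

section MatrixRegularity

variable {m : ℕ} {M : Type*} [TopologicalSpace M] [ChartedSpace (Model m) M]
  [IsManifold (𝓡 (2 * m + 1)) ∞ M] {ι : Type*} [Fintype ι] [DecidableEq ι] {p : M}

theorem SmoothFun.sum {κ : Type*} {s : Finset κ} {f : κ → M → ℝ}
    (hf : ∀ i ∈ s, SmoothFun m (f i) p) : SmoothFun m (fun q ↦ ∑ i ∈ s, f i q) p :=
  contMDiffAt_finsetSum hf

theorem SmoothFun.prod {κ : Type*} {s : Finset κ} {f : κ → M → ℝ}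
    (hf : ∀ i ∈ s, SmoothFun m (f i) p) : SmoothFun m (fun q ↦ ∏ i ∈ s, f i q) p :=
  contMDiffAt_finsetProd hf

theorem SmoothFun.inv {f : M → ℝ} (hf : SmoothFun m f p) (h0 : f p ≠ 0) :
    SmoothFun m (fun q ↦ (f q)⁻¹) p :=
  ContMDiffAt.inv₀ hf h0

theorem SmoothFun.det {G : M → Matrix ι ι ℝ} (hG : ∀ i j, SmoothFun m (fun q ↦ G q i j) p) :
    SmoothFun m (fun q ↦ (G q).det) p := by
  simp only [Matrix.det_apply']
  exact .sum fun σ _ ↦ (smoothFun_const _).mul (.prod fun i _ ↦ hG _ _)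

/-- Cramer's rule: the entry is `det⁻¹` times the determinant of `G` with one row replaced by a
constant unit vector. -/
theorem SmoothFun.matrix_inv {G : M → Matrix ι ι ℝ}
    (hG : ∀ i j, SmoothFun m (fun q ↦ G q i j) p) (h0 : (G p).det ≠ 0) (i j : ι) :
    SmoothFun m (fun q ↦ (G q)⁻¹ i j) p := by
  simp only [Matrix.inv_def, Ring.inverse_eq_inv', Matrix.smul_apply, smul_eq_mul,
    Matrix.adjugate_apply]
  refine (SmoothFun.det hG).inv h0 |>.mul (.det fun k l ↦ ?_)
  by_cases hk : k = j
  · subst hk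
    simpa using smoothFun_const _
  · simpa [Matrix.updateRow_ne hk] using hG k l

end MatrixRegularity

/-! ### Gram matrices, raising of indices and tensoriality. -/

namespace AlmostContactMetric

variable {m : ℕ} {M : Type*} [TopologicalSpace M] [ChartedSpace (Model m) M]
  [IsManifold (𝓡 (2 * m + 1)) ∞ M] (A : AlmostContactMetric m M)
  {X Y Z : VF m M} {p : M}

/-- The Gram matrix of `g` at `q` in a finite family of vector fields. -/
def frameGram {ι : Type*} (E : ι → VF m M) (q : M) : Matrix ι ι ℝ :=
  Matrix.of fun i j ↦ A.metric (E i) (E j) q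

section FrameGram

variable {ι : Type*} [Fintype ι] [DecidableEq ι] {E : ι → VF m M} {q : M}

theorem frameGram_mulVec (c : ι → ℝ) (i : ι) :
    (A.frameGram E q).mulVec c i = A.g q (∑ j, c j • E j q) (E i q) := by
  simp [Matrix.mulVec, dotProduct, frameGram, metric, A.g_symm q (E i q), mul_comm]

/-- The combination of the fields `E i` with the prescribed products with the `E j`. -/
theorem g_sum_inv_frameGram (h0 : IsUnit (A.frameGram E q).det) (a : ι → ℝ) (k : ι) :
    A.g q (∑ i, (∑ j, (A.frameGram E q)⁻¹ i j * a j) • E i q) (E k q) = a k := by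
  rw [← A.frameGram_mulVec]
  change (A.frameGram E q).mulVec ((A.frameGram E q)⁻¹.mulVec a) k = a k
  rw [Matrix.mulVec_mulVec, Matrix.mul_nonsing_inv _ h0, Matrix.one_mulVec]

theorem linearIndependent_of_frameGram (h0 : IsUnit (A.frameGram E q).det) :
    LinearIndependent ℝ fun i ↦ E i q := by
  rw [Fintype.linearIndependent_iff]
  intro c hc i
  have h1 : (A.frameGram E q).mulVec c = 0 := by
    ext i
    rw [A.frameGram_mulVec, hc]; simp
  have h2 : c = (A.frameGram E q)⁻¹.mulVec ((A.frameGram E q).mulVec c) := by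
    rw [Matrix.mulVec_mulVec, Matrix.nonsing_inv_mul _ h0, Matrix.one_mulVec]
  rw [h2, h1, Matrix.mulVec_zero]; rfl

/-- Nondegeneracy is asked only on the span of the family, so that the lemma covers both frames of
`T_q M` and the frame `e_a` of `D`. A kernel vector of the Gram matrix is a combination orthogonal
to the whole family. -/
theorem isUnit_frameGram_det (hE : LinearIndependent ℝ fun i ↦ E i q)
    (hnd : ∀ c : ι → ℝ, (∀ i, A.g q (∑ j, c j • E j q) (E i q) = 0) → ∑ j, c j • E j q = 0) :
    IsUnit (A.frameGram E q).det := by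
  rw [isUnit_iff_ne_zero]
  intro h0
  obtain ⟨c, hc, hc0⟩ := Matrix.exists_mulVec_eq_zero_iff.2 h0
  refine hc (funext ((Fintype.linearIndependent_iff.1 hE) c (hnd c fun i ↦ ?_)))
  rw [← A.frameGram_mulVec, hc0]; rfl

end FrameGram

theorem finrank_tangentSpace (p : M) :
    Module.finrank ℝ (TangentSpace (𝓡 (2 * m + 1)) p) = 2 * m + 1 := by
  change Module.finrank ℝ (EuclideanSpace ℝ (Fin (2 * m + 1))) = _
  simp

theorem gram_eq_frameGram (p : M) : A.gram p = A.frameGram (localFrame p) p := rfl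

theorem isUnit_gram_det (p : M) : IsUnit (A.gram p).det := by
  rw [gram_eq_frameGram]
  refine A.isUnit_frameGram_det ?_ fun c hc ↦ A.g_nondegenerate p _ fun v ↦ ?_
  · simpa using (stdBasis p).linearIndependent
  · rw [← (stdBasis p).sum_repr v, map_sum]
    refine Finset.sum_eq_zero fun i _ ↦ ?_
    have := hc i
    rw [localFrame_self] at this
    rw [map_smul, this, smul_zero]

theorem g_sharp_stdBasis (α : VF m M → M → ℝ) (p : M) (k : Fin (2 * m + 1)) :
    A.g p (A.sharp α p) (stdBasis p k) = α (localFrame p k) p := by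
  have := A.g_sum_inv_frameGram (A.isUnit_gram_det p) (fun j ↦ α (localFrame p j) p) k
  simp only [localFrame_self] at this
  exact this

theorem g_ext_stdBasis {u v : TangentSpace (𝓡 (2 * m + 1)) p}
    (h : ∀ k, A.g p u (stdBasis p k) = A.g p v (stdBasis p k)) : u = v := by
  rw [← sub_eq_zero]
  refine A.g_nondegenerate p _ fun w ↦ ?_
  rw [← (stdBasis p).sum_repr w, map_sum]
  refine Finset.sum_eq_zero fun i _ ↦ ?_
  rw [map_smul, map_sub, _root_.sub_apply, h, sub_self, smul_zero]

theorem sharp_eq {α : VF m M → M → ℝ} {v : TangentSpace (𝓡 (2 * m + 1)) p}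
    (h : ∀ Z : VF m M, SmoothAt Z p → A.g p v (Z p) = α Z p) : A.sharp α p = v := by
  refine A.g_ext_stdBasis fun k ↦ ?_
  rw [g_sharp_stdBasis, ← h _ (smoothAt_localFrame p k), localFrame_self]

/-- The defining property of `sharp`. -/
theorem g_sharp {α : VF m M → M → ℝ}
    (hα : TensorialAt (𝓡 (2 * m + 1)) (Model m) (fun Z : VF m M ↦ α Z p) p) (hZ : DiffVF Z p) :
    A.g p (A.sharp α p) (Z p) = α Z p := by
  rw [← TensorialAt.mkHom_apply hα hZ]
  have h : (A.g p (A.sharp α p)) = TensorialAt.mkHom _ p hα := by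
    refine ContinuousLinearMap.coe_injective ((stdBasis p).ext fun k ↦ ?_)
    have := TensorialAt.mkHom_apply hα (smoothAt_localFrame p k).diff
    rw [localFrame_self] at this
    exact (A.g_sharp_stdBasis α p k).trans this.symm
  rw [h]

/-! ### Smooth local frames -/

/-- Here the frame centred at `p` is used at nearby points `q`. The formula for `sharp` uses at each
point the frame centred there, so smoothness must come from a fixed frame and the defining property
of `sharp`. -/
theorem smoothFun_frameGram (p : M) (i j : Fin (2 * m + 1)) :
    SmoothFun m (fun q ↦ A.frameGram (localFrame p) q i j) p :=
  A.smoothFun_metric (smoothAt_localFrame p i) (smoothAt_localFrame p j)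

theorem eventually_isUnit_frameGram (p : M) :
    ∀ᶠ q in 𝓝 p, IsUnit (A.frameGram (localFrame p) q).det := by
  have h : SmoothFun m (fun q ↦ (A.frameGram (localFrame p) q).det) p :=
    .det (A.smoothFun_frameGram p)
  have h0 : (A.frameGram (localFrame p) p).det ≠ 0 := (A.isUnit_gram_det p).ne_zero
  filter_upwards [(ContMDiffAt.continuousAt h).eventually_ne h0] with q hq
  exact hq.isUnit

theorem smoothFun_inv_frameGram (p : M) (i j : Fin (2 * m + 1)) :
    SmoothFun m (fun q ↦ (A.frameGram (localFrame p) q)⁻¹ i j) p :=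
  .matrix_inv (A.smoothFun_frameGram p) (A.isUnit_gram_det p).ne_zero i j

/-- The expansion of tangent vectors at points near `p` in the frame `localFrame p`. -/
theorem eventually_eq_frame_sum (p : M) :
    ∀ᶠ q in 𝓝 p, ∀ v : TangentSpace (𝓡 (2 * m + 1)) q,
      v = ∑ i, (∑ j, (A.frameGram (localFrame p) q)⁻¹ i j * A.g q v (localFrame p j q))
        • localFrame p i q := by
  filter_upwards [A.eventually_isUnit_frameGram p] with q hq v
  have hli := A.linearIndependent_of_frameGram hq
  have hsp : ⊤ ≤ Submodule.span ℝ (range fun i : Fin (2 * m + 1) ↦ localFrame (m := m) p i q) := by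
    have : FiniteDimensional ℝ (TangentSpace (𝓡 (2 * m + 1)) q) :=
      inferInstanceAs (FiniteDimensional ℝ (Model m))
    rw [hli.span_eq_top_of_card_eq_finrank' (by rw [finrank_tangentSpace (m := m) q]; simp)]
  rw [← sub_eq_zero]
  refine A.g_nondegenerate q _ fun w ↦ ?_
  induction hsp (Submodule.mem_top : w ∈ ⊤) using Submodule.span_induction with
  | mem x hx =>
    obtain ⟨k, rfl⟩ := hx
    rw [map_sub, _root_.sub_apply,
      A.g_sum_inv_frameGram hq (fun j ↦ A.g q v (localFrame p j q)) k, sub_self]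
  | zero => simp
  | add x y _ _ hx hy => rw [map_add, hx, hy, add_zero]
  | smul a x _ hx => rw [map_smul, hx, smul_zero]

/-- A vector field is smooth if its products with a smooth frame are. -/
theorem smoothAt_of_metric_localFrame (h : ∀ j, SmoothFun m (A.metric X (localFrame p j)) p) :
    SmoothAt X p := by
  have hs : SmoothAt (fun q ↦ ∑ i, (fun q ↦ ∑ j, (A.frameGram (localFrame p) q)⁻¹ i j
      * A.metric X (localFrame p j) q) q • localFrame p i q) p :=
    ContMDiffAt.sum_section fun i _ ↦ SmoothAt.smul (.sum fun j _ ↦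
      (A.smoothFun_inv_frameGram p i j).mul (h j)) (smoothAt_localFrame p i)
  refine hs.congr ?_
  filter_upwards [A.eventually_eq_frame_sum p] with q hq
  exact hq (X q)

/-- The smoothness of `sharp α` for tensorial and smooth `α`. -/
theorem smoothAt_sharp {α : VF m M → M → ℝ}
    (h1 : ∀ Z : VF m M, SmoothAt Z p → ∀ᶠ q in 𝓝 p, A.g q (A.sharp α q) (Z q) = α Z q)
    (h2 : ∀ Z : VF m M, SmoothAt Z p → SmoothFun m (α Z) p) : SmoothAt (A.sharp α) p :=
  A.smoothAt_of_metric_localFrame fun j ↦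
    (h2 _ (smoothAt_localFrame p j)).congr (h1 _ (smoothAt_localFrame p j))

/-- An operation on vector fields that is local, additive and linear over functions vanishes on
smooth fields that vanish at the point. -/
theorem eq_zero_of_tensorial {V : Type*} [AddCommGroup V] [Module ℝ V] (A : AlmostContactMetric m M)
    {T : VF m M → V}
    (hcongr : ∀ X Y : VF m M, SmoothAt X p → SmoothAt Y p → (∀ᶠ q in 𝓝 p, X q = Y q) → T X = T Y)
    (hadd : ∀ X Y : VF m M, SmoothAt X p → SmoothAt Y p → T (X + Y) = T X + T Y)
    (hsmul : ∀ (f : M → ℝ) (X : VF m M), SmoothFun m f p → SmoothAt X p → T (f • X) = f p • T X)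
    (hX : SmoothAt X p) (hX0 : X p = 0) : T X = 0 := by
  -- Near `p` the field is `∑ c i • E_i` with smooth coefficients that vanish at `p`; linearity over
  -- functions then gives `T X = ∑ c i p • T E_i = 0`.
  set c : Fin (2 * m + 1) → M → ℝ := fun i q ↦ ∑ j, (A.frameGram (localFrame p) q)⁻¹ i j
      * A.metric X (localFrame p j) q with hc
  have hcs (i) : SmoothFun m (c i) p := .sum fun j _ ↦
      (A.smoothFun_inv_frameGram p i j).mul (A.smoothFun_metric hX (smoothAt_localFrame p j))
  have hc0 (i) : c i p = 0 := by simp [hc, metric, hX0]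
  have hs (s : Finset (Fin (2 * m + 1))) :
      SmoothAt (∑ i ∈ s, c i • localFrame p i) p ∧ T (∑ i ∈ s, c i • localFrame p i) = 0 := by
    classical
    induction s using Finset.induction_on with
    | empty =>
      have h0 : SmoothAt (0 : VF m M) p :=
        (hX.sub hX).congr (.of_forall fun q ↦ by simp)
      refine ⟨by simpa using h0, ?_⟩
      have := hadd 0 0 h0 h0
      simpa using this
    | insert i s hi ih =>
      have h1 := SmoothAt.smul (hcs i) (smoothAt_localFrame p i)
      rw [Finset.sum_insert hi]
      refine ⟨h1.add ih.1, ?_⟩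
      rw [hadd _ _ h1 ih.1, ih.2, hsmul _ _ (hcs i) (smoothAt_localFrame p i), hc0]; simp
  rw [hcongr X _ hX (hs Finset.univ).1 ?_, (hs Finset.univ).2]
  filter_upwards [A.eventually_eq_frame_sum p] with q hq
  rw [Finset.sum_apply]
  exact hq (X q)

end AlmostContactMetric

namespace AlmostContactMetric

variable {m : ℕ} {M : Type*} [TopologicalSpace M] [ChartedSpace (Model m) M]
  [IsManifold (𝓡 (2 * m + 1)) ∞ M] (A : AlmostContactMetric m M)
  {X Y Z X' Y' : VF m M} {f : M → ℝ} {p : M}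

/-! ### The form `ω` and the endomorphism `ψ` -/

theorem omega_swap : A.omega X Y p = -A.omega Y X p := by
  simp only [omega, eta, bracket_swap (X := X), map_neg]; ring

theorem omega_congr (hX : ∀ᶠ q in 𝓝 p, X q = X' q) (hY : ∀ᶠ q in 𝓝 p, Y q = Y' q) :
    A.omega X Y p = A.omega X' Y' p := by
  have h1 : dirDeriv X (A.eta Y) p = dirDeriv X' (A.eta Y') p :=
    (dirDeriv_congr (hY.mono fun q hq ↦ by simp only [eta, hq])).trans
      (dirDeriv_congr_left hX.self_of_nhds)
  have h2 : dirDeriv Y (A.eta X) p = dirDeriv Y' (A.eta X') p :=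
    (dirDeriv_congr (hX.mono fun q hq ↦ by simp only [eta, hq])).trans
      (dirDeriv_congr_left hY.self_of_nhds)
  rw [omega, omega, h1, h2, eta, eta, bracket_congr hX hY]

theorem tensorialAt_omega (X : VF m M) (p : M) :
    TensorialAt (𝓡 (2 * m + 1)) (Model m) (fun Y : VF m M ↦ A.omega X Y p) p where
  smul := by
    intro f Y hf hY
    simp only [omega, eta_smul, dirDeriv_mul hf (A.diffFun_eta hY), dirDeriv_smul_left]
    simp only [eta, bracket_smul_right hf hY, map_add, map_smul, smul_eq_mul]
    ring
  add := by
    intro Y Z hY hZ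
    simp only [omega, eta_add, dirDeriv_add (A.diffFun_eta hY) (A.diffFun_eta hZ),
      dirDeriv_add_left]
    simp only [eta, bracket_add_right hY hZ, map_add]
    ring

theorem g_psi (hY : DiffVF Y p) :
    A.g p (A.psi X p) (Y p) = A.omega X Y p :=
  A.g_sharp (A.tensorialAt_omega X p) hY

theorem g_psi_right (hY : DiffVF Y p) :
    A.g p (Y p) (A.psi X p) = A.omega X Y p := by
  rw [A.g_symm, A.g_psi hY]

theorem g_psi_swap (hX : DiffVF X p) (hY : DiffVF Y p) :
    A.g p (A.psi X p) (Y p) = -A.g p (X p) (A.psi Y p) := by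
  rw [A.g_psi hY, A.g_psi_right hX, omega_swap]

/-- Skewness moves `ψ` onto the test field, after which the argument enters only through its value
at `p`. -/
theorem psi_congr_point (hX : DiffVF X p) (hY : DiffVF Y p) (h : X p = Y p) :
    A.psi X p = A.psi Y p :=
  A.eq_of_g_eq fun Z hZ ↦ by rw [A.g_psi_swap hX hZ.diff, A.g_psi_swap hY hZ.diff, h]

theorem omega_congr_point (hX : DiffVF X p) (hX' : DiffVF X' p) (hY : DiffVF Y p)
    (hY' : DiffVF Y' p) (h : X p = X' p) (h' : Y p = Y' p) :
    A.omega X Y p = A.omega X' Y' p := by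
  rw [← A.g_psi hY, ← A.g_psi hY', A.psi_congr_point hX hX' h, h']

theorem smoothFun_omega (hX : SmoothAt X p) (hY : SmoothAt Y p) :
    SmoothFun m (A.omega X Y) p :=
  (smoothFun_const (1 / 2)).mul
    (((A.smoothFun_dirDeriv hX (A.smoothFun_eta hY)).sub
      (A.smoothFun_dirDeriv hY (A.smoothFun_eta hX))).sub (A.smoothFun_eta (hX.bracket hY)))

theorem smoothAt_psi (hX : SmoothAt X p) : SmoothAt (A.psi X) p := by
  refine A.smoothAt_sharp (fun Z hZ ↦ ?_) fun Z hZ ↦ A.smoothFun_omega hX hZ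
  filter_upwards [hZ.eventually_diff] with q h2
  exact A.g_psi h2

/-! ### The Levi-Civita connection -/

/-- The right-hand side of the Koszul formula. -/
def koszul (X Y Z : VF m M) (p : M) : ℝ :=
  (1 / 2) *
    (dirDeriv X (A.metric Y Z) p + dirDeriv Y (A.metric X Z) p - dirDeriv Z (A.metric X Y) p
      + A.metric (bracket X Y) Z p - A.metric (bracket X Z) Y p - A.metric (bracket Y Z) X p)

theorem leviCivita_eq_sharp : A.leviCivita X Y = A.sharp (A.koszul X Y) := rfl

theorem tensorialAt_koszul (hX : DiffVF X p) (hY : DiffVF Y p) :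
    TensorialAt (𝓡 (2 * m + 1)) (Model m) (fun Z : VF m M ↦ A.koszul X Y Z p) p where
  smul := by
    intro f Z hf hZ
    simp only [koszul, metric_smul_right, dirDeriv_mul hf (A.diffFun_metric hY hZ),
      dirDeriv_mul hf (A.diffFun_metric hX hZ), dirDeriv_smul_left]
    simp only [metric, bracket_smul_right hf hZ, map_add, map_smul, smul_eq_mul,
      _root_.add_apply, _root_.smul_apply, A.g_symm p (Z p)]
    simp only [Pi.mul_apply, metric]
    ring
  add := by
    intro Z W hZ hW
    simp only [koszul, metric_add_right, dirDeriv_add (A.diffFun_metric hY hZ)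
      (A.diffFun_metric hY hW), dirDeriv_add (A.diffFun_metric hX hZ)
      (A.diffFun_metric hX hW), dirDeriv_add_left]
    simp only [metric, bracket_add_right hZ hW, map_add, _root_.add_apply, Pi.add_apply]
    ring

theorem g_leviCivita (hX : DiffVF X p) (hY : DiffVF Y p) (hZ : DiffVF Z p) :
    A.g p (A.leviCivita X Y p) (Z p) = A.koszul X Y Z p :=
  A.g_sharp (A.tensorialAt_koszul hX hY) hZ

theorem smoothAt_leviCivita (hX : SmoothAt X p) (hY : SmoothAt Y p) :
    SmoothAt (A.leviCivita X Y) p := by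
  refine A.smoothAt_sharp (α := A.koszul X Y) (fun Z hZ ↦ ?_) fun Z hZ ↦ ?_
  · filter_upwards [hX.eventually_diff, hY.eventually_diff, hZ.eventually_diff] with q h1 h2 h3
    exact A.g_leviCivita h1 h2 h3
  · have d {U V W : VF m M} (hU : SmoothAt U p) (hV : SmoothAt V p) (hW : SmoothAt W p) :=
      A.smoothFun_dirDeriv hU (A.smoothFun_metric hV hW)
    have b {U V W : VF m M} (hU : SmoothAt U p) (hV : SmoothAt V p) (hW : SmoothAt W p) :=
      A.smoothFun_metric (hU.bracket hV) hW
    exact (smoothFun_const (1 / 2)).mul ((((((d hX hY hZ).add (d hY hX hZ)).sub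
      (d hZ hX hY)).add (b hX hY hZ)).sub (b hX hZ hY)).sub (b hY hZ hX))

theorem leviCivita_torsion (hX : DiffVF X p) (hY : DiffVF Y p) :
    A.leviCivita X Y p = A.leviCivita Y X p + bracket X Y p := by
  refine A.eq_of_g_eq fun Z hZ ↦ ?_
  rw [A.g_leviCivita hX hY hZ.diff, map_add, _root_.add_apply, A.g_leviCivita hY hX hZ.diff]
  simp only [koszul, A.metric_symm (X := Y) (Y := X)]
  simp only [metric, bracket_swap (X := Y) (Y := X), map_neg, _root_.neg_apply]
  ring

theorem dirDeriv_metric (hX : DiffVF X p) (hY : DiffVF Y p) (hZ : DiffVF Z p) :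
    dirDeriv X (A.metric Y Z) p =
      A.g p (A.leviCivita X Y p) (Z p) + A.g p (Y p) (A.leviCivita X Z p) := by
  rw [A.g_symm p (Y p), A.g_leviCivita hX hY hZ, A.g_leviCivita hX hZ hY]
  simp only [koszul, A.metric_symm (X := Z) (Y := Y)]
  simp only [metric, bracket_swap (X := Z) (Y := Y), map_neg, _root_.neg_apply]
  ring

theorem leviCivita_smul_left (hf : DiffFun m f p) (hX : DiffVF X p) (hY : DiffVF Y p) :
    A.leviCivita (f • X) Y p = f p • A.leviCivita X Y p := by
  refine A.eq_of_g_eq fun Z hZ ↦ ?_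
  rw [A.g_leviCivita (.smul hf hX) hY hZ.diff, map_smul, _root_.smul_apply,
    A.g_leviCivita hX hY hZ.diff]
  simp only [koszul, metric_smul_left, dirDeriv_mul hf (A.diffFun_metric hX hY),
      dirDeriv_mul hf (A.diffFun_metric hX hZ.diff), dirDeriv_smul_left]
  simp only [metric, bracket_smul_left hf hX, map_add, map_smul, smul_eq_mul, map_neg,
    _root_.neg_apply, _root_.add_apply, _root_.smul_apply, Pi.smul_apply']
  ring

theorem leviCivita_add_left (hX : DiffVF X p) (hY : DiffVF Y p) (hZ : DiffVF Z p) :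
    A.leviCivita (X + Y) Z p = A.leviCivita X Z p + A.leviCivita Y Z p := by
  refine A.eq_of_g_eq fun W hW ↦ ?_
  rw [A.g_leviCivita (hX.add hY) hZ hW.diff, map_add, _root_.add_apply,
    A.g_leviCivita hX hZ hW.diff, A.g_leviCivita hY hZ hW.diff]
  simp only [koszul, metric_add_left, dirDeriv_add (A.diffFun_metric hX hZ) (A.diffFun_metric hY hZ),
      dirDeriv_add (A.diffFun_metric hX hW.diff) (A.diffFun_metric hY hW.diff), dirDeriv_add_left]
  simp only [metric, bracket_add_left hX hY, map_add, _root_.add_apply, Pi.add_apply]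
  ring

/-- Vanishing torsion exchanges the two arguments, so linearity on the left and the Leibniz rule of
the bracket suffice. -/
theorem leviCivita_smul_right (hf : DiffFun m f p) (hX : DiffVF X p) (hY : DiffVF Y p) :
    A.leviCivita X (f • Y) p = dirDeriv X f p • Y p + f p • A.leviCivita X Y p := by
  rw [A.leviCivita_torsion hX (.smul hf hY), A.leviCivita_smul_left hf hY hX,
    A.leviCivita_torsion hX hY, bracket_smul_right hf hY, smul_add]
  abel

theorem leviCivita_add_right (hX : DiffVF X p) (hY : DiffVF Y p) (hZ : DiffVF Z p) :
    A.leviCivita X (Y + Z) p = A.leviCivita X Y p + A.leviCivita X Z p := by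
  rw [A.leviCivita_torsion hX (hY.add hZ), A.leviCivita_add_left hY hZ hX,
    A.leviCivita_torsion hX hY, A.leviCivita_torsion hX hZ, bracket_add_right hY hZ]
  abel

/-- Tested only on the frame in the definition of `sharp`; tensoriality is not used, hence no
regularity is needed. -/
theorem leviCivita_congr (hX : ∀ᶠ q in 𝓝 p, X q = X' q) (hY : ∀ᶠ q in 𝓝 p, Y q = Y' q) :
    A.leviCivita X Y p = A.leviCivita X' Y' p := by
  refine A.g_ext_stdBasis fun k ↦ ?_
  rw [leviCivita_eq_sharp, leviCivita_eq_sharp, g_sharp_stdBasis, g_sharp_stdBasis]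
  have hr {Z : VF m M} : ∀ᶠ q in 𝓝 p, Z q = Z q := .of_forall fun _ ↦ rfl
  have hm {U U' V V' : VF m M} (hU : ∀ᶠ q in 𝓝 p, U q = U' q) (hV : ∀ᶠ q in 𝓝 p, V q = V' q) :
      ∀ᶠ q in 𝓝 p, A.metric U V q = A.metric U' V' q := by
    filter_upwards [hU, hV] with q h1 h2
    simp only [metric, h1, h2]
  set Z : VF m M := localFrame p k
  rw [koszul, koszul, dirDeriv_congr (hm hY (hr (Z := Z))), dirDeriv_congr (hm hX (hr (Z := Z))),
    dirDeriv_congr (X := Z) (hm hX hY), dirDeriv_congr_left hX.self_of_nhds,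
    dirDeriv_congr_left hY.self_of_nhds]
  simp only [metric, bracket_congr hX hY, bracket_congr hX (hr (Z := Z)),
    bracket_congr hY (hr (Z := Z)), hX.self_of_nhds, hY.self_of_nhds]

/-! ### The Lie derivative of the metric along `ξ` -/

/-- `(L_ξ g)(X, Y)`. -/
def lieMetric (X Y : VF m M) (p : M) : ℝ :=
  dirDeriv A.ξ (A.metric X Y) p - A.metric (bracket A.ξ X) Y p - A.metric X (bracket A.ξ Y) p

theorem lieMetric_symm : A.lieMetric X Y p = A.lieMetric Y X p := by
  simp only [lieMetric, A.metric_symm (X := Y) (Y := X), A.metric_symm (X := X) (Y := bracket _ _),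
    A.metric_symm (X := Y) (Y := bracket _ _)]
  ring

theorem tensorialAt_lieMetric (hX : DiffVF X p) :
    TensorialAt (𝓡 (2 * m + 1)) (Model m) (fun Y : VF m M ↦ A.lieMetric X Y p) p where
  smul := by
    intro f Y hf hY
    simp only [lieMetric, metric_smul_right, dirDeriv_mul hf (A.diffFun_metric hX hY)]
    simp only [metric, bracket_smul_right hf hY, map_add, map_smul, smul_eq_mul, Pi.mul_apply]
    ring
  add := by
    intro Y Z hY hZ
    simp only [lieMetric, metric_add_right,
      dirDeriv_add (A.diffFun_metric hX hY) (A.diffFun_metric hX hZ)]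
    simp only [metric, bracket_add_right hY hZ, map_add, Pi.add_apply]
    ring

end AlmostContactMetric

namespace AlmostContactMetric

variable {m : ℕ} {M : Type*} [TopologicalSpace M] [ChartedSpace (Model m) M]
  [IsManifold (𝓡 (2 * m + 1)) ∞ M] {A : AlmostContactMetric m M}
  {X Y Z X' Y' : VF m M} {f : M → ℝ} {p : M}

theorem psi_add (hX : DiffVF X p) (hY : DiffVF Y p) :
    A.psi (X + Y) p = A.psi X p + A.psi Y p := by
  refine A.eq_of_g_eq fun Z hZ ↦ ?_
  rw [A.g_psi_swap (hX.add hY) hZ.diff, map_add, _root_.add_apply, A.g_psi_swap hX hZ.diff,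
    A.g_psi_swap hY hZ.diff, Pi.add_apply, map_add, _root_.add_apply, neg_add]

theorem psi_smul (hf : DiffFun m f p) (hX : DiffVF X p) :
    A.psi (f • X) p = f p • A.psi X p := by
  refine A.eq_of_g_eq fun Z hZ ↦ ?_
  rw [A.g_psi_swap (.smul hf hX) hZ.diff, map_smul, _root_.smul_apply, A.g_psi_swap hX hZ.diff,
    Pi.smul_apply', map_smul, _root_.smul_apply, smul_neg]

theorem omega_add_left (hX : DiffVF X p) (hY : DiffVF Y p) (hZ : DiffVF Z p) :
    A.omega (X + Y) Z p = A.omega X Z p + A.omega Y Z p := by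
  simp only [← A.g_psi hZ, psi_add hX hY, map_add, _root_.add_apply]

theorem omega_smul_left (hf : DiffFun m f p) (hX : DiffVF X p) (hZ : DiffVF Z p) :
    A.omega (f • X) Z p = f p * A.omega X Z p := by
  simp only [← A.g_psi hZ, psi_smul hf hX, map_smul, _root_.smul_apply, smul_eq_mul]

theorem eta_ξ : A.eta A.ξ = fun _ ↦ 1 := funext fun q ↦ A.η_ξ q

theorem phi_ξ_eq_zero : A.phi A.ξ = 0 := funext fun q ↦ A.phi_ξ q

namespace IsAlmostQuasiSasakian

/-! ### Consequences of the definition: `ξ` is a Killing field -/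

theorem omega_ξ_left (hA : A.IsAlmostQuasiSasakian) (hX : DiffVF X p) : A.omega A.ξ X p = 0 := by
  rw [A.omega_congr_point (A.diffVF_ξ p) (A.diffVF_ξ p) hX (diffVF_extendVF (X p)) rfl
    (extendVF_self _).symm]
  exact hA.omega_ξ p _ (smoothAt_extendVF _)

theorem omega_ξ_right (hA : A.IsAlmostQuasiSasakian) (hX : DiffVF X p) : A.omega X A.ξ p = 0 := by
  rw [A.omega_swap, hA.omega_ξ_left hX, neg_zero]

/-- This is `L_ξ η = 0`: as `η(ξ)` is constant, `2dη(ξ, X)` reduces to `ξη(X) - η([ξ, X])`. -/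
theorem eta_bracket_ξ (hA : A.IsAlmostQuasiSasakian) (hX : DiffVF X p) :
    A.η p (bracket A.ξ X p) = dirDeriv A.ξ (A.eta X) p := by
  have h := hA.omega_ξ_left hX
  simp only [omega, eta_ξ, dirDeriv_const] at h
  simp only [eta] at h ⊢
  linarith

theorem psi_ξ (hA : A.IsAlmostQuasiSasakian) (p : M) : A.psi A.ξ p = 0 :=
  A.eq_of_g_eq fun Z hZ ↦ by
    rw [A.g_psi hZ.diff, hA.omega_ξ_left hZ.diff, map_zero, _root_.zero_apply]

theorem η_psi (hA : A.IsAlmostQuasiSasakian) (hX : DiffVF X p) : A.η p (A.psi X p) = 0 := by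
  rw [← A.g_ξ_right, A.g_psi (A.diffVF_ξ p), hA.omega_ξ_right hX]

/-- This is `L_ξ φ = 0`. As `φξ = 0`, almost normality on `(ξ, X)` reduces to `φ(φ[ξ, X] - [ξ, φX])
= 0`. The vector in parentheses lies in `D`, where `φ` is injective. -/
theorem bracket_ξ_phi (hA : A.IsAlmostQuasiSasakian) (hX : SmoothAt X p) :
    bracket A.ξ (A.phi X) p = A.φ p (bracket A.ξ X p) := by
  have h := hA.almostNormal p A.ξ X (A.smoothAt_ξ p) hX
  have h0 : A.omega 0 (A.phi X) p = 0 := by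
    have hd : DiffVF (0 : VF m M) p := by
      simpa using (A.diffVF_ξ p).sub (A.diffVF_ξ p)
    rw [A.omega_swap, ← A.g_psi hd]; simp
  simp only [nijenhuis, phi_ξ_eq_zero, bracket_zero_left, h0, mul_zero, zero_smul, add_zero,
    zero_add] at h
  have h1 : A.η p (bracket A.ξ (A.phi X) p) = 0 := by
    rw [hA.eta_bracket_ξ (A.diffVF_phi hX.diff)]
    have : A.eta (A.phi X) = fun _ ↦ 0 := funext fun q ↦ A.η_φ q _
    rw [this, dirDeriv_const]
  have h2 : A.φ p (A.φ p (bracket A.ξ X p) - bracket A.ξ (A.phi X) p) = 0 := by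
    simp only [phi, bracket_zero_left, map_zero, sub_zero] at h
    rw [map_sub]
    exact h
  have h3 := congrArg (A.φ p) h2
  rw [A.φ_sq, map_zero, map_sub, A.η_φ, h1, sub_self, zero_smul, add_zero, neg_sub,
    sub_eq_zero] at h3
  exact h3

/-- Because `Ω(ξ, ·) = 0`, the equation `dΩ(ξ, Y, Z) = 0` says `L_ξ Ω = 0`; since `L_ξ` commutes
with `φ`, it falls on `g` alone. -/
theorem lieMetric_phi (hA : A.IsAlmostQuasiSasakian) (hY : SmoothAt Y p) (hZ : SmoothAt Z p) :
    A.lieMetric Y (A.phi Z) p = 0 := by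
  have h := hA.closed p A.ξ Y Z (A.smoothAt_ξ p) hY hZ
  have h1 : A.fundForm Z A.ξ = fun _ ↦ 0 := by
    ext q; simp [fundForm, metric, phi_ξ_eq_zero]
  have h2 : A.fundForm A.ξ Y = fun _ ↦ 0 := by
    ext q; simp [fundForm, metric, A.g_ξ_left, phi, A.η_φ]
  have h3 : A.fundForm (bracket Z A.ξ) Y p = A.metric Y (bracket A.ξ (A.phi Z)) p := by
    rw [fundForm, metric, metric, hA.bracket_ξ_phi hZ, phi, bracket_swap, map_neg,
      _root_.neg_apply, ← A.g_φ_left, A.g_symm]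
  have h4 : A.fundForm (bracket Y Z) A.ξ p = 0 := by
    simp [fundForm, metric, phi_ξ_eq_zero]
  simp only [dFundForm, h1, h2, h3, h4, dirDeriv_const] at h
  simp only [lieMetric]
  have h5 : A.fundForm Y Z = A.metric Y (A.phi Z) := rfl
  have h6 : A.fundForm (bracket A.ξ Y) Z p = A.metric (bracket A.ξ Y) (A.phi Z) p := rfl
  rw [h5, h6] at h
  linarith

theorem lieMetric_ξ (hA : A.IsAlmostQuasiSasakian) (hY : DiffVF Y p) :
    A.lieMetric Y A.ξ p = 0 := by
  have h : A.metric Y A.ξ = A.eta Y := funext fun q ↦ A.g_ξ_right q _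
  simp [lieMetric, h, metric, A.g_ξ_right, hA.eta_bracket_ξ hY]

/-- `ξ` is Killing: every field is `-φ(φW) + η(W)ξ`, and `L_ξ g` vanishes when its second argument
is in the image of `φ` or is `ξ`. -/
theorem lieMetric_eq_zero (hA : A.IsAlmostQuasiSasakian) (hY : DiffVF Y p) (hZ : DiffVF Z p) :
    A.lieMetric Y Z p = 0 := by
  have hs {V W : VF m M} (hV : SmoothAt V p) (hW : SmoothAt W p) : A.lieMetric V W p = 0 := by
    have e : W = (fun _ : M ↦ (-1 : ℝ)) • A.phi (A.phi W) + A.eta W • A.ξ := by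
      ext q : 1
      simp [phi, A.φ_sq, eta]
    have t := A.tensorialAt_lieMetric hV.diff
    have hd := A.diffVF_phi (A.diffVF_phi hW.diff)
    rw [e, t.add (DiffVF.smul (diffFun_const _) hd)
      (DiffVF.smul (A.diffFun_eta hW.diff) (A.diffVF_ξ p)), t.smul (diffFun_const _) hd,
      t.smul (A.diffFun_eta hW.diff) (A.diffVF_ξ p), hA.lieMetric_phi hV (A.smoothAt_phi hW),
      hA.lieMetric_ξ hV.diff]
    simp
  rw [(A.tensorialAt_lieMetric hY).pointwise hZ (diffVF_extendVF (Z p)) (extendVF_self _).symm,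
    A.lieMetric_symm, (A.tensorialAt_lieMetric (diffVF_extendVF (Z p))).pointwise hY
    (diffVF_extendVF (Y p)) (extendVF_self _).symm]
  exact hs (smoothAt_extendVF _) (smoothAt_extendVF _)

/-- The Koszul formula splits `g(∇̃_X ξ, Z)` into a symmetric part `½ L_ξ g`, which is zero, and the
skew part `dη`. -/
theorem leviCivita_ξ (hA : A.IsAlmostQuasiSasakian) (hX : DiffVF X p) :
    A.leviCivita X A.ξ p = A.psi X p := by
  refine A.eq_of_g_eq fun Z hZ ↦ ?_
  rw [A.g_leviCivita hX (A.diffVF_ξ p) hZ.diff, A.g_psi hZ.diff]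
  have h := hA.lieMetric_eq_zero hX hZ.diff
  have h1 (W : VF m M) : A.metric W A.ξ = A.eta W := funext fun q ↦ A.g_ξ_right q _
  have h2 (W : VF m M) : A.metric A.ξ W = A.eta W := funext fun q ↦ A.g_ξ_left q _
  simp only [lieMetric] at h
  simp only [koszul, omega, h1, h2]
  have h3 : A.metric (bracket X A.ξ) Z p = -A.metric (bracket A.ξ X) Z p := by
    simp [metric, bracket_swap (X := X)]
  rw [h3, A.metric_symm (X := bracket A.ξ Z)]
  linarith

theorem covEta_eq (hA : A.IsAlmostQuasiSasakian) (hX : DiffVF X p) (hY : DiffVF Y p) :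
    A.covEta X Y p = A.omega X Y p := by
  have h1 : A.eta Y = A.metric Y A.ξ := (funext fun q ↦ A.g_ξ_right q _).symm
  rw [covEta, h1, A.dirDeriv_metric hX hY (A.diffVF_ξ p), hA.leviCivita_ξ hX, A.g_psi_right hY,
    A.g_ξ_right, eta]
  ring

theorem endoC_eq_zero (hA : A.IsAlmostQuasiSasakian) (hX : DiffVF X p) : A.endoC X p = 0 :=
  A.sharp_eq fun Z hZ ↦ by
    have h := hA.lieMetric_eq_zero hX hZ.diff
    rw [lieMetric] at h
    rw [h, map_zero, _root_.zero_apply, mul_zero]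

/-! ### The canonical connection -/

/-- The working form of the connection: `C` and `∇̃_ξ η` vanish, and `N = 2ψ` turns `-(ψ - N)` into
`+ψ`. -/
theorem canonical_eq (hA : A.IsAlmostQuasiSasakian) (hX : DiffVF X p) (hY : DiffVF Y p) :
    A.canonical X Y p = A.leviCivita X Y p + A.omega X Y p • A.ξ p - A.eta Y p • A.psi X p
      + A.eta X p • A.psi Y p := by
  rw [canonical, nConnection, hA.covEta_eq hX hY, hA.covEta_eq (A.diffVF_ξ p) hY,
    hA.omega_ξ_left hY, hA.leviCivita_ξ hX, hA.endoC_eq_zero hY]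
  module

theorem smoothAt_canonical (hA : A.IsAlmostQuasiSasakian) (hX : SmoothAt X p)
    (hY : SmoothAt Y p) : SmoothAt (A.canonical X Y) p := by
  have h := (((A.smoothAt_leviCivita hX hY).add (.smul (A.smoothFun_omega hX hY)
    (A.smoothAt_ξ p))).sub (.smul (A.smoothFun_eta hY) (A.smoothAt_psi hX))).add
    (.smul (A.smoothFun_eta hX) (A.smoothAt_psi hY))
  refine h.congr ?_
  filter_upwards [hX.eventually_diff, hY.eventually_diff] with q h1 h2
  exact hA.canonical_eq h1 h2

theorem canonical_congr (hA : A.IsAlmostQuasiSasakian) (hX : DiffVF X p) (hY : DiffVF Y p)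
    (hX' : DiffVF X' p) (hY' : DiffVF Y' p)
    (h : ∀ᶠ q in 𝓝 p, X q = X' q) (h' : ∀ᶠ q in 𝓝 p, Y q = Y' q) :
    A.canonical X Y p = A.canonical X' Y' p := by
  rw [hA.canonical_eq hX hY, hA.canonical_eq hX' hY', A.leviCivita_congr h h',
    A.omega_congr h h', eta, eta, eta, eta, h.self_of_nhds, h'.self_of_nhds,
    A.psi_congr_point hX hX' h.self_of_nhds, A.psi_congr_point hY hY' h'.self_of_nhds]

theorem canonical_add_left (hA : A.IsAlmostQuasiSasakian) (hX : DiffVF X p) (hY : DiffVF Y p)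
    (hZ : DiffVF Z p) :
    A.canonical (X + Y) Z p = A.canonical X Z p + A.canonical Y Z p := by
  rw [hA.canonical_eq (hX.add hY) hZ, hA.canonical_eq hX hZ, hA.canonical_eq hY hZ,
    A.leviCivita_add_left hX hY hZ, omega_add_left hX hY hZ, psi_add hX hY, A.eta_add,
    Pi.add_apply]
  module

theorem canonical_smul_left (hA : A.IsAlmostQuasiSasakian) (hf : DiffFun m f p) (hX : DiffVF X p)
    (hY : DiffVF Y p) : A.canonical (f • X) Y p = f p • A.canonical X Y p := by
  rw [hA.canonical_eq (.smul hf hX) hY, hA.canonical_eq hX hY,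
    A.leviCivita_smul_left hf hX hY, omega_smul_left hf hX hY, psi_smul hf hX, A.eta_smul,
    Pi.mul_apply]
  module

theorem canonical_add_right (hA : A.IsAlmostQuasiSasakian) (hX : DiffVF X p) (hY : DiffVF Y p)
    (hZ : DiffVF Z p) :
    A.canonical X (Y + Z) p = A.canonical X Y p + A.canonical X Z p := by
  rw [hA.canonical_eq hX (hY.add hZ), hA.canonical_eq hX hY, hA.canonical_eq hX hZ,
    A.leviCivita_add_right hX hY hZ, A.omega_swap, omega_add_left hY hZ hX,
    A.omega_swap (X := X) (Y := Y), A.omega_swap (X := X) (Y := Z), psi_add hY hZ, A.eta_add,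
    Pi.add_apply]
  module

theorem canonical_smul_right (hA : A.IsAlmostQuasiSasakian) (hf : DiffFun m f p)
    (hX : DiffVF X p) (hY : DiffVF Y p) :
    A.canonical X (f • Y) p = dirDeriv X f p • Y p + f p • A.canonical X Y p := by
  rw [hA.canonical_eq hX (.smul hf hY), hA.canonical_eq hX hY,
    A.leviCivita_smul_right hf hX hY, A.omega_swap, omega_smul_left hf hY hX,
    A.omega_swap (X := X) (Y := Y), psi_smul hf hY, A.eta_smul, Pi.mul_apply]
  module

theorem canonical_congr_left (hA : A.IsAlmostQuasiSasakian) (hX : DiffVF X p) (hX' : DiffVF X' p)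
    (hY : DiffVF Y p) (h : X p = X' p) : A.canonical X Y p = A.canonical X' Y p := by
  have t : TensorialAt (𝓡 (2 * m + 1)) (Model m) (fun X : VF m M ↦ A.canonical X Y p) p :=
    { smul := fun hf hX ↦ hA.canonical_smul_left hf hX hY
      add := fun hX hX' ↦ hA.canonical_add_left hX hX' hY }
  exact t.pointwise hX hX' h

theorem canonical_ξ (hA : A.IsAlmostQuasiSasakian) (hX : DiffVF X p) :
    A.canonical X A.ξ p = 0 := by
  rw [hA.canonical_eq hX (A.diffVF_ξ p), hA.leviCivita_ξ hX, hA.omega_ξ_right hX, hA.psi_ξ,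
    eta, A.η_ξ]
  module

/-- Metricity is inherited from `∇̃`: the correction `ω(X, ·)ξ - η(·)ψX` is a skew endomorphism, and
so is `η(X)ψ`. -/
theorem dirDeriv_metric_canonical (hA : A.IsAlmostQuasiSasakian) (hX : DiffVF X p)
    (hY : DiffVF Y p) (hZ : DiffVF Z p) :
    dirDeriv X (A.metric Y Z) p =
      A.g p (A.canonical X Y p) (Z p) + A.g p (Y p) (A.canonical X Z p) := by
  rw [A.dirDeriv_metric hX hY hZ, hA.canonical_eq hX hY, hA.canonical_eq hX hZ]
  simp only [map_add, map_sub, map_smul, _root_.add_apply, _root_.sub_apply, _root_.smul_apply,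
    smul_eq_mul, A.g_ξ_left, A.g_ξ_right, A.g_psi hZ, A.g_psi_right hY, eta]
  rw [A.omega_swap (X := Z) (Y := Y)]
  ring

theorem dirDeriv_eta (hA : A.IsAlmostQuasiSasakian) (hX : DiffVF X p) (hY : DiffVF Y p) :
    dirDeriv X (A.eta Y) p = A.η p (A.canonical X Y p) := by
  have h1 : A.eta Y = A.metric Y A.ξ := (funext fun q ↦ A.g_ξ_right q _).symm
  rw [h1, hA.dirDeriv_metric_canonical hX hY (A.diffVF_ξ p), hA.canonical_ξ hX, A.g_ξ_right,
    map_zero, add_zero]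

theorem torsion_eq (hA : A.IsAlmostQuasiSasakian) (hX : DiffVF X p) (hY : DiffVF Y p) :
    A.torsion X Y p = (2 * A.omega X Y p) • A.ξ p - (2 * A.eta Y p) • A.psi X p
      + (2 * A.eta X p) • A.psi Y p := by
  rw [torsion, hA.canonical_eq hX hY, hA.canonical_eq hY hX, A.leviCivita_torsion hX hY,
    A.omega_swap (X := Y) (Y := X)]
  module

theorem canonical_torsion (hA : A.IsAlmostQuasiSasakian) (hX : DiffVF X p) (hY : DiffVF Y p) :
    A.canonical X Y p = A.canonical Y X p + bracket X Y p + ((2 * A.omega X Y p) • A.ξ p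
      - (2 * A.eta Y p) • A.psi X p + (2 * A.eta X p) • A.psi Y p) := by
  rw [← hA.torsion_eq hX hY, torsion]; abel

/-- `∇^N_ξ = L_ξ + N`. This is the source of the term with `ψ` that separates the canonical
curvature from the Schouten tensor. -/
theorem canonical_ξ_left (hA : A.IsAlmostQuasiSasakian) (hX : DiffVF X p) :
    A.canonical A.ξ X p = bracket A.ξ X p + (2 : ℝ) • A.psi X p := by
  rw [hA.canonical_torsion (A.diffVF_ξ p) hX, hA.canonical_ξ hX, hA.omega_ξ_left hX, hA.psi_ξ,
    eta_ξ]
  module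

/-- Up to a factor this is `η ∧ ω`. As `η` is parallel, only `∇^N ω` can obstruct parallel torsion.
-/
theorem torsion3_eq (hA : A.IsAlmostQuasiSasakian) (hX : DiffVF X p) (hY : DiffVF Y p)
    (hZ : DiffVF Z p) :
    A.torsion3 X Y Z p = 2 * (A.omega X Y p * A.eta Z p - A.eta Y p * A.omega X Z p
      + A.eta X p * A.omega Y Z p) := by
  rw [torsion3, metric, hA.torsion_eq hX hY]
  simp only [map_add, map_sub, map_smul, _root_.add_apply, _root_.sub_apply, _root_.smul_apply,
    smul_eq_mul, A.g_ξ_left, A.g_psi hZ]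
  simp only [eta]
  ring

end IsAlmostQuasiSasakian

end AlmostContactMetric

/-! ### The covariant derivative of `ω` and parallel torsion. -/

namespace AlmostContactMetric

variable {m : ℕ} {M : Type*} [TopologicalSpace M] [ChartedSpace (Model m) M]
  [IsManifold (𝓡 (2 * m + 1)) ∞ M] {A : AlmostContactMetric m M}
  {W X Y Z X' Y' : VF m M} {f : M → ℝ} {p : M}

/-- The covariant derivative `(∇^N_W ω)(X, Y)` with respect to the canonical connection. -/
def nablaOmega (A : AlmostContactMetric m M) (W X Y : VF m M) (p : M) : ℝ :=
  dirDeriv W (A.omega X Y) p - A.omega (A.canonical W X) Y p - A.omega X (A.canonical W Y) p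

theorem omega_eq_neg_g_psi (hX : DiffVF X p) : A.omega X Y p = -A.g p (A.psi Y p) (X p) := by
  rw [A.omega_swap, A.g_psi hX]

theorem AdmissibleAt.eventually (hX : A.AdmissibleAt X p) :
    ∀ᶠ q in 𝓝 p, DiffVF X q ∧ ∀ᶠ r in 𝓝 q, A.η r (X r) = 0 := by
  filter_upwards [hX.1.eventually_diff, eventually_eventually_nhds.2 hX.2] with q h1 h2
  exact ⟨h1, h2⟩

theorem dirDeriv_eta_of_eventually (hX : ∀ᶠ r in 𝓝 p, A.η r (X r) = 0) :
    dirDeriv W (A.eta X) p = 0 := by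
  rw [dirDeriv_congr (f := A.eta X) (h := fun _ ↦ 0) hX, dirDeriv_const]

theorem omega_of_eventually (hX : ∀ᶠ r in 𝓝 p, A.η r (X r) = 0)
    (hY : ∀ᶠ r in 𝓝 p, A.η r (Y r) = 0) :
    A.omega X Y p = -(1 / 2) * A.eta (bracket X Y) p := by
  rw [omega, dirDeriv_eta_of_eventually hX, dirDeriv_eta_of_eventually hY]; ring

namespace IsAlmostQuasiSasakian

/-- Here the covariant derivatives occur only through their values at `p`, so that pointwise
identities for the connection can be substituted. -/
theorem nablaOmega_eq (hA : A.IsAlmostQuasiSasakian) (hW : SmoothAt W p) (hX : SmoothAt X p)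
    (hY : SmoothAt Y p) :
    A.nablaOmega W X Y p = dirDeriv W (A.omega X Y) p + A.g p (A.psi Y p) (A.canonical W X p)
      - A.g p (A.psi X p) (A.canonical W Y p) := by
  rw [nablaOmega, omega_eq_neg_g_psi (hA.smoothAt_canonical hW hX).diff,
    A.g_psi (hA.smoothAt_canonical hW hY).diff]
  ring

theorem nablaOmega_ξ_right (hA : A.IsAlmostQuasiSasakian) (hW : SmoothAt W p)
    (hX : SmoothAt X p) : A.nablaOmega W X A.ξ p = 0 := by
  rw [hA.nablaOmega_eq hW hX (A.smoothAt_ξ p), hA.psi_ξ, hA.canonical_ξ hW.diff,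
    dirDeriv_congr (h := fun _ ↦ 0), dirDeriv_const]
  · simp
  · filter_upwards [hX.eventually_diff] with q hq
    exact hA.omega_ξ_right hq

theorem dirDeriv_torsion3 (hA : A.IsAlmostQuasiSasakian) (hW : SmoothAt W p) (hX : SmoothAt X p)
    (hY : SmoothAt Y p) (hZ : SmoothAt Z p) :
    dirDeriv W (A.torsion3 X Y Z) p - A.torsion3 (A.canonical W X) Y Z p
      - A.torsion3 X (A.canonical W Y) Z p - A.torsion3 X Y (A.canonical W Z) p =
    2 * (A.nablaOmega W X Y p * A.eta Z p - A.eta Y p * A.nablaOmega W X Z p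
      + A.eta X p * A.nablaOmega W Y Z p) := by
  have hc {V : VF m M} (hV : SmoothAt V p) := (hA.smoothAt_canonical hW hV).diff
  have ho {U V : VF m M} (hU : SmoothAt U p) (hV : SmoothAt V p) := (A.smoothFun_omega hU hV).diff
  have he {U : VF m M} (hU : SmoothAt U p) := A.diffFun_eta hU.diff
  have e : dirDeriv W (A.torsion3 X Y Z) p = dirDeriv W ((fun _ ↦ 2) * (A.omega X Y * A.eta Z
      - A.eta Y * A.omega X Z + A.eta X * A.omega Y Z)) p := by
    refine dirDeriv_congr ?_
    filter_upwards [hX.eventually_diff, hY.eventually_diff, hZ.eventually_diff] with q h1 h2 h3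
    exact hA.torsion3_eq h1 h2 h3
  rw [e, dirDeriv_mul (diffFun_const 2) (((((ho hX hY).mul (he hZ)).sub
    ((he hY).mul (ho hX hZ))).add ((he hX).mul (ho hY hZ)))), dirDeriv_const,
    dirDeriv_add (((ho hX hY).mul (he hZ)).sub ((he hY).mul (ho hX hZ)))
      ((he hX).mul (ho hY hZ)),
    dirDeriv_sub ((ho hX hY).mul (he hZ)) ((he hY).mul (ho hX hZ)),
    dirDeriv_mul (ho hX hY) (he hZ), dirDeriv_mul (he hY) (ho hX hZ),
    dirDeriv_mul (he hX) (ho hY hZ), hA.torsion3_eq (hc hX) hY.diff hZ.diff,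
    hA.torsion3_eq hX.diff (hc hY) hZ.diff, hA.torsion3_eq hX.diff hY.diff (hc hZ),
    hA.dirDeriv_eta hW.diff hX.diff, hA.dirDeriv_eta hW.diff hY.diff,
    hA.dirDeriv_eta hW.diff hZ.diff]
  simp only [nablaOmega, eta]
  ring

theorem hasParallelTorsion_iff_nablaOmega (hA : A.IsAlmostQuasiSasakian) :
    A.HasParallelTorsion ↔ ∀ p W X Y, SmoothAt W p → SmoothAt X p → SmoothAt Y p →
      A.nablaOmega W X Y p = 0 := by
  constructor
  · intro h p W X Y hW hX hY
    -- Choosing `ξ` as third argument isolates `∇^N ω(X, Y)`: the other two terms contain `ξ`, which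
    -- is parallel and annihilated by `ω`.
    have h1 := h p W X Y A.ξ hW hX hY (A.smoothAt_ξ p)
    rw [hA.dirDeriv_torsion3 hW hX hY (A.smoothAt_ξ p), hA.nablaOmega_ξ_right hW hX,
      hA.nablaOmega_ξ_right hW hY, eta_ξ] at h1
    linarith
  · intro h p W X Y Z hW hX hY hZ
    rw [hA.dirDeriv_torsion3 hW hX hY hZ, h p W X Y hW hX hY, h p W X Z hW hX hZ,
      h p W Y Z hW hY hZ]
    ring

theorem canonical_projP (hA : A.IsAlmostQuasiSasakian) (hW : DiffVF W p) (hX : DiffVF X p) :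
    A.canonical W (A.projP X) p = A.projP (A.canonical W X) p := by
  have e : A.projP X = X + ((fun _ : M ↦ (-1 : ℝ)) * A.eta X) • A.ξ := by
    ext q : 1
    simp [projP, eta, sub_eq_add_neg]
  have hd : DiffFun m ((fun _ : M ↦ (-1 : ℝ)) * A.eta X) p :=
    (diffFun_const _).mul (A.diffFun_eta hX)
  rw [e, hA.canonical_add_right hW hX (.smul hd (A.diffVF_ξ p)),
    hA.canonical_smul_right hd hW (A.diffVF_ξ p), hA.canonical_ξ hW,
    dirDeriv_mul (diffFun_const _) (A.diffFun_eta hX), dirDeriv_const, hA.dirDeriv_eta hW hX,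
    projP]
  module

theorem psi_projP (hA : A.IsAlmostQuasiSasakian) (hX : DiffVF X p) :
    A.psi (A.projP X) p = A.psi X p := by
  have e : A.projP X = X + ((fun _ : M ↦ (-1 : ℝ)) * A.eta X) • A.ξ := by
    ext q : 1
    simp [projP, eta, sub_eq_add_neg]
  have hd : DiffFun m ((fun _ : M ↦ (-1 : ℝ)) * A.eta X) p :=
    (diffFun_const _).mul (A.diffFun_eta hX)
  rw [e, psi_add hX (.smul hd (A.diffVF_ξ p)), psi_smul hd (A.diffVF_ξ p), hA.psi_ξ, smul_zero,
    add_zero]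

theorem g_psi_sub_smul_ξ (hA : A.IsAlmostQuasiSasakian) (hX : DiffVF X p)
    (v : TangentSpace (𝓡 (2 * m + 1)) p) (c : ℝ) :
    A.g p (A.psi X p) (v - c • A.ξ p) = A.g p (A.psi X p) v := by
  rw [map_sub, map_smul, A.g_ξ_right, hA.η_psi hX, smul_zero, sub_zero]

theorem omega_projP (hA : A.IsAlmostQuasiSasakian) (hX : DiffVF X p) (hY : DiffVF Y p) :
    A.omega (A.projP X) (A.projP Y) p = A.omega X Y p := by
  rw [← A.g_psi (A.diffVF_projP hY), hA.psi_projP hX, ← A.g_psi hY, projP,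
    hA.g_psi_sub_smul_ξ hX]

theorem nablaOmega_projP (hA : A.IsAlmostQuasiSasakian) (hW : SmoothAt W p) (hX : SmoothAt X p)
    (hY : SmoothAt Y p) :
    A.nablaOmega W (A.projP X) (A.projP Y) p = A.nablaOmega W X Y p := by
  rw [hA.nablaOmega_eq hW (A.smoothAt_projP hX) (A.smoothAt_projP hY), hA.nablaOmega_eq hW hX hY,
    hA.psi_projP hX.diff, hA.psi_projP hY.diff, hA.canonical_projP hW.diff hX.diff,
    hA.canonical_projP hW.diff hY.diff, projP, projP, hA.g_psi_sub_smul_ξ hX.diff,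
    hA.g_psi_sub_smul_ξ hY.diff, dirDeriv_congr (h := A.omega X Y)]
  filter_upwards [hX.eventually_diff, hY.eventually_diff] with q h1 h2
  exact hA.omega_projP h1 h2

theorem admissibleAt_bracket_ξ (hA : A.IsAlmostQuasiSasakian) (hX : A.AdmissibleAt X p) :
    A.AdmissibleAt (bracket A.ξ X) p := by
  refine ⟨(A.smoothAt_ξ p).bracket hX.1, ?_⟩
  filter_upwards [hX.eventually] with q hq
  rw [hA.eta_bracket_ξ hq.1, dirDeriv_eta_of_eventually hq.2]

/-- `∇^N_ξ ω = 0` holds without any assumption on the torsion. -/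
theorem nablaOmega_ξ_left (hA : A.IsAlmostQuasiSasakian) (hX : A.AdmissibleAt X p)
    (hY : A.AdmissibleAt Y p) : A.nablaOmega A.ξ X Y p = 0 := by
  have hξ := A.smoothAt_ξ p
  -- On `D` one has `ω(X, Y) = -½ η([X, Y])`, so `L_ξ ω = 0` follows from the Jacobi identity and
  -- `L_ξ η = 0`.
  have h1 : dirDeriv A.ξ (A.omega X Y) p
      = dirDeriv A.ξ ((fun _ ↦ -(1 / 2)) * A.eta (bracket X Y)) p := by
    refine dirDeriv_congr ?_
    filter_upwards [hX.eventually, hY.eventually] with q h1 h2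
    exact omega_of_eventually h1.2 h2.2
  have hb := (hX.1.bracket hY.1).diff
  rw [hA.nablaOmega_eq hξ hX.1 hY.1, h1, dirDeriv_mul (diffFun_const _) (A.diffFun_eta hb),
    dirDeriv_const, ← hA.eta_bracket_ξ hb, bracket_jacobi hξ hX.1 hY.1,
    hA.canonical_ξ_left hX.1.diff, hA.canonical_ξ_left hY.1.diff, map_add, map_add, map_add]
  have h2 := omega_of_eventually (hA.admissibleAt_bracket_ξ hX).2 hY.2
  have h3 := omega_of_eventually hX.2 (hA.admissibleAt_bracket_ξ hY).2
  rw [omega_eq_neg_g_psi (hξ.bracket hX.1).diff] at h2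
  rw [← A.g_psi (hξ.bracket hY.1).diff] at h3
  -- The `2ψ` in `∇^N_ξ = L_ξ + 2ψ` contributes `2g(ψY, ψX) - 2g(ψX, ψY)`, which cancels.
  rw [map_smul, map_smul, A.g_symm p (A.psi Y p) (A.psi X p)]
  simp only [eta] at h2 h3
  linarith

theorem nablaOmega_split (hA : A.IsAlmostQuasiSasakian) (hW : SmoothAt W p) (hX : SmoothAt X p)
    (hY : SmoothAt Y p) : A.nablaOmega W X Y p =
      A.nablaOmega (A.projP W) X Y p + A.eta W p * A.nablaOmega A.ξ X Y p := by
  have hP := A.smoothAt_projP hW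
  have hη := A.smoothFun_eta hW
  have hξ := A.smoothAt_ξ p
  have e : W = A.projP W + A.eta W • A.ξ := by
    ext q : 1
    simp [projP, eta]
  have hc {V : VF m M} (hV : SmoothAt V p) :
      A.canonical W V p = A.canonical (A.projP W) V p + A.eta W p • A.canonical A.ξ V p := by
    conv_lhs => rw [e]
    rw [hA.canonical_add_left hP.diff (.smul hη.diff hξ.diff) hV.diff,
      hA.canonical_smul_left hη.diff hξ.diff hV.diff]
  have hd : dirDeriv W (A.omega X Y) p
      = dirDeriv (A.projP W) (A.omega X Y) p + A.eta W p * dirDeriv A.ξ (A.omega X Y) p := by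
    conv_lhs => rw [e]
    rw [dirDeriv_add_left, dirDeriv_smul_left]
  rw [hA.nablaOmega_eq hW hX hY, hA.nablaOmega_eq hP hX hY, hA.nablaOmega_eq hξ hX hY, hc hX,
    hc hY, hd]
  simp only [map_add, map_smul, smul_eq_mul]
  ring

/-- On sections of `D` the canonical connection is the interior connection. -/
theorem interior_eq_canonical (hA : A.IsAlmostQuasiSasakian) (hX : DiffVF X p) (hX0 : A.η p (X p) = 0)
    (hY : DiffVF Y p) (hY0 : ∀ᶠ r in 𝓝 p, A.η r (Y r) = 0) :
    A.interior X Y p = A.canonical X Y p := by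
  have h1 := hA.dirDeriv_eta hX hY
  have h2 := hA.canonical_eq hX hY
  rw [eta, eta, hX0, hY0.self_of_nhds] at h2
  rw [dirDeriv_eta_of_eventually hY0, h2] at h1
  simp only [map_add, map_sub, map_smul, A.η_ξ, smul_eq_mul] at h1
  rw [h2, interior, projP]
  -- The canonical derivative stays in `D`, so the correction `ω(X, Y)ξ` is exactly what the
  -- projection `P` removes.
  have h3 : A.omega X Y p = -A.η p (A.leviCivita X Y p) := by linarith
  rw [h3]
  module

theorem interior_eventuallyEq_canonical (hA : A.IsAlmostQuasiSasakian) (hX : A.AdmissibleAt X p)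
    (hY : A.AdmissibleAt Y p) : ∀ᶠ q in 𝓝 p, A.interior X Y q = A.canonical X Y q := by
  filter_upwards [hX.eventually, hY.eventually] with q h1 h2
  exact hA.interior_eq_canonical h1.1 h1.2.self_of_nhds h2.1 h2.2

theorem admissibleAt_canonical (hA : A.IsAlmostQuasiSasakian) (hX : SmoothAt X p)
    (hY : A.AdmissibleAt Y p) : A.AdmissibleAt (A.canonical X Y) p := by
  refine ⟨hA.smoothAt_canonical hX hY.1, ?_⟩
  filter_upwards [hX.eventually_diff, hY.eventually] with q h1 h2
  rw [← hA.dirDeriv_eta h1 h2.1, dirDeriv_eta_of_eventually h2.2]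

theorem nablaOmega_eq_interior (hA : A.IsAlmostQuasiSasakian) (hX : A.AdmissibleAt X p)
    (hY : A.AdmissibleAt Y p) (hZ : A.AdmissibleAt Z p) :
    dirDeriv X (A.omega Y Z) p - A.omega (A.interior X Y) Z p - A.omega Y (A.interior X Z) p =
      A.nablaOmega X Y Z p := by
  rw [nablaOmega, A.omega_congr (hA.interior_eventuallyEq_canonical hX hY) (.of_forall fun _ ↦ rfl),
    A.omega_congr (.of_forall fun _ ↦ rfl) (hA.interior_eventuallyEq_canonical hX hZ)]

/-- The torsion of the canonical connection is parallel if and only if `∇ω = 0`. -/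
theorem hasParallelTorsion_iff (hA : A.IsAlmostQuasiSasakian) :
    A.HasParallelTorsion ↔ A.IsOmegaParallel := by
  rw [hA.hasParallelTorsion_iff_nablaOmega]
  constructor
  · intro h p X Y Z hX hY hZ
    rw [hA.nablaOmega_eq_interior hX hY hZ]
    exact h p X Y Z hX.1 hY.1 hZ.1
  · intro h p W X Y hW hX hY
    have hPW := A.admissibleAt_projP hW
    have hPX := A.admissibleAt_projP hX
    have hPY := A.admissibleAt_projP hY
    -- `ω` and `∇^N` do not see the `ξ`-parts of `X` and `Y`; the `ξ`-part of `W` contributes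
    -- nothing because `∇^N_ξ ω = 0`.
    rw [← hA.nablaOmega_projP hW hX hY, hA.nablaOmega_split hW hPX.1 hPY.1,
      hA.nablaOmega_ξ_left hPX hPY, ← hA.nablaOmega_eq_interior hPW hPX hPY,
      h p _ _ _ hPW hPX hPY]
    ring

end IsAlmostQuasiSasakian

end AlmostContactMetric

namespace AlmostContactMetric

variable {m : ℕ} {M : Type*} [TopologicalSpace M] [ChartedSpace (Model m) M]
  [IsManifold (𝓡 (2 * m + 1)) ∞ M] {A : AlmostContactMetric m M}
  {W X Y Z X' Y' Z' : VF m M} {f : M → ℝ} {p : M}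

theorem eq_projP_add (A : AlmostContactMetric m M) (X : VF m M) :
    X = A.projP X + A.eta X • A.ξ := by
  ext q : 1
  simp [projP, eta]

namespace IsAlmostQuasiSasakian

/-! ### The curvature of the canonical connection -/

theorem dirDeriv_dirDeriv_metric (hA : A.IsAlmostQuasiSasakian) (hX : SmoothAt X p)
    (hY : SmoothAt Y p) (hZ : SmoothAt Z p) (hW : SmoothAt W p) :
    dirDeriv X (dirDeriv Y (A.metric Z W)) p =
      A.g p (A.canonical X (A.canonical Y Z) p) (W p)
        + A.g p (A.canonical Y Z p) (A.canonical X W p)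
        + (A.g p (A.canonical X Z p) (A.canonical Y W p)
        + A.g p (Z p) (A.canonical X (A.canonical Y W) p)) := by
  have hYZ := hA.smoothAt_canonical hY hZ
  have hYW := hA.smoothAt_canonical hY hW
  rw [dirDeriv_congr (h := A.metric (A.canonical Y Z) W + A.metric Z (A.canonical Y W)),
    dirDeriv_add (A.diffFun_metric hYZ.diff hW.diff) (A.diffFun_metric hZ.diff hYW.diff),
    hA.dirDeriv_metric_canonical hX.diff hYZ.diff hW.diff,
    hA.dirDeriv_metric_canonical hX.diff hZ.diff hYW.diff]
  filter_upwards [hY.eventually_diff, hZ.eventually_diff, hW.eventually_diff] with q h1 h2 h3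
  exact hA.dirDeriv_metric_canonical h1 h2 h3

/-- `[X, Y]` acts on the function `g(Z, W)` as a commutator; expanding by metricity, the mixed
products cancel. This also yields tensoriality in `Z`, since `Z` enters the right-hand side only by
its value. -/
theorem g_curvature_skew (hA : A.IsAlmostQuasiSasakian) (hX : SmoothAt X p)
    (hY : SmoothAt Y p) (hZ : SmoothAt Z p) (hW : SmoothAt W p) :
    A.g p (A.curvature X Y Z p) (W p) = -A.g p (Z p) (A.curvature X Y W p) := by
  have h := A.dirDeriv_bracket hX hY (A.smoothFun_metric hZ hW)
  rw [hA.dirDeriv_dirDeriv_metric hX hY hZ hW, hA.dirDeriv_dirDeriv_metric hY hX hZ hW,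
    hA.dirDeriv_metric_canonical (hX.bracket hY).diff hZ.diff hW.diff] at h
  simp only [curvature, map_sub, _root_.sub_apply]
  linarith

theorem canonical_zero_right (hA : A.IsAlmostQuasiSasakian) (hX : DiffVF X p) :
    A.canonical X 0 p = 0 := by
  have hd : DiffVF (0 : VF m M) p := by simpa using (A.diffVF_ξ p).sub (A.diffVF_ξ p)
  have := hA.canonical_add_right hX hd hd
  simpa using this

theorem curvature_ξ (hA : A.IsAlmostQuasiSasakian) (hX : SmoothAt X p) (hY : SmoothAt Y p) :
    A.curvature X Y A.ξ p = 0 := by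
  have hd : DiffVF (0 : VF m M) p := by simpa using (A.diffVF_ξ p).sub (A.diffVF_ξ p)
  have h {U V : VF m M} (hU : SmoothAt U p) (hV : SmoothAt V p) :
      A.canonical U (A.canonical V A.ξ) p = 0 := by
    rw [hA.canonical_congr hU.diff (hA.smoothAt_canonical hV (A.smoothAt_ξ p)).diff hU.diff hd
      (.of_forall fun _ ↦ rfl) ?_, hA.canonical_zero_right hU.diff]
    filter_upwards [hV.eventually_diff] with q hq
    exact hA.canonical_ξ hq
  rw [curvature, h hX hY, h hY hX, hA.canonical_ξ (hX.bracket hY).diff]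
  simp

theorem η_curvature (hA : A.IsAlmostQuasiSasakian) (hX : SmoothAt X p) (hY : SmoothAt Y p)
    (hZ : SmoothAt Z p) : A.η p (A.curvature X Y Z p) = 0 := by
  rw [← A.g_ξ_right, hA.g_curvature_skew hX hY hZ (A.smoothAt_ξ p), hA.curvature_ξ hX hY]
  simp

theorem curvature_congr_right (hA : A.IsAlmostQuasiSasakian) (hX : SmoothAt X p)
    (hY : SmoothAt Y p) (hZ : SmoothAt Z p) (hZ' : SmoothAt Z' p) (h : Z p = Z' p) :
    A.curvature X Y Z p = A.curvature X Y Z' p :=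
  A.eq_of_g_eq fun W hW ↦ by
    rw [hA.g_curvature_skew hX hY hZ hW, hA.g_curvature_skew hX hY hZ' hW, h]

theorem curvature_add_right (hA : A.IsAlmostQuasiSasakian) (hX : SmoothAt X p)
    (hY : SmoothAt Y p) (hZ : SmoothAt Z p) (hZ' : SmoothAt Z' p) :
    A.curvature X Y (Z + Z') p = A.curvature X Y Z p + A.curvature X Y Z' p :=
  A.eq_of_g_eq fun W hW ↦ by
    rw [map_add, _root_.add_apply, hA.g_curvature_skew hX hY hZ hW,
      hA.g_curvature_skew hX hY hZ' hW, hA.g_curvature_skew hX hY (hZ.add hZ') hW, Pi.add_apply,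
      map_add, _root_.add_apply, neg_add]

theorem curvature_smul_right (hA : A.IsAlmostQuasiSasakian) (hX : SmoothAt X p)
    (hY : SmoothAt Y p) (hf : SmoothFun m f p) (hZ : SmoothAt Z p) :
    A.curvature X Y (f • Z) p = f p • A.curvature X Y Z p :=
  A.eq_of_g_eq fun W hW ↦ by
    rw [map_smul, _root_.smul_apply, hA.g_curvature_skew hX hY hZ hW,
      hA.g_curvature_skew hX hY (.smul hf hZ) hW, Pi.smul_apply', map_smul, _root_.smul_apply,
      smul_neg]

theorem curvature_projP_right (hA : A.IsAlmostQuasiSasakian) (hX : SmoothAt X p)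
    (hY : SmoothAt Y p) (hZ : SmoothAt Z p) :
    A.curvature X Y (A.projP Z) p = A.curvature X Y Z p := by
  conv_rhs => rw [A.eq_projP_add Z]
  rw [hA.curvature_add_right hX hY (A.smoothAt_projP hZ)
    (.smul (A.smoothFun_eta hZ) (A.smoothAt_ξ p)),
    hA.curvature_smul_right hX hY (A.smoothFun_eta hZ) (A.smoothAt_ξ p), hA.curvature_ξ hX hY,
    smul_zero, add_zero]

theorem curvature_swap (hA : A.IsAlmostQuasiSasakian) (hX : SmoothAt X p)
    (hY : SmoothAt Y p) (hZ : SmoothAt Z p) :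
    A.curvature X Y Z p = -A.curvature Y X Z p := by
  have h : A.canonical (bracket X Y) Z p = -A.canonical (bracket Y X) Z p := by
    rw [hA.canonical_congr_left (hX.bracket hY).diff
      (DiffVF.smul (diffFun_const (-1)) (hY.bracket hX).diff) hZ.diff (by rw [bracket_swap]; simp),
      hA.canonical_smul_left (diffFun_const _) (hY.bracket hX).diff hZ.diff]
    simp
  rw [curvature, curvature, h]
  abel

theorem curvature_congr_left (hA : A.IsAlmostQuasiSasakian) (hX : SmoothAt X p)
    (hX' : SmoothAt X' p) (hY : SmoothAt Y p) (hZ : SmoothAt Z p)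
    (h : ∀ᶠ q in 𝓝 p, X q = X' q) : A.curvature X Y Z p = A.curvature X' Y Z p := by
  have hr {V : VF m M} : ∀ᶠ q in 𝓝 p, V q = V q := .of_forall fun _ ↦ rfl
  have h1 : A.canonical Y (A.canonical X Z) p = A.canonical Y (A.canonical X' Z) p := by
    refine hA.canonical_congr hY.diff (hA.smoothAt_canonical hX hZ).diff hY.diff
      (hA.smoothAt_canonical hX' hZ).diff hr ?_
    filter_upwards [hX.eventually_diff, hX'.eventually_diff, hZ.eventually_diff, h]
      with q h1 h2 h3 h4
    exact hA.canonical_congr_left h1 h2 h3 h4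
  rw [curvature, curvature, h1, hA.canonical_congr_left hX.diff hX'.diff
    (hA.smoothAt_canonical hY hZ).diff h.self_of_nhds, hA.canonical_congr_left
    (hX.bracket hY).diff (hX'.bracket hY).diff hZ.diff (bracket_congr h hr)]

theorem curvature_add_left (hA : A.IsAlmostQuasiSasakian) (hX : SmoothAt X p)
    (hX' : SmoothAt X' p) (hY : SmoothAt Y p) (hZ : SmoothAt Z p) :
    A.curvature (X + X') Y Z p = A.curvature X Y Z p + A.curvature X' Y Z p := by
  have hXZ := hA.smoothAt_canonical hX hZ
  have hXZ' := hA.smoothAt_canonical hX' hZ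
  have h1 : A.canonical Y (A.canonical (X + X') Z) p
      = A.canonical Y (A.canonical X Z + A.canonical X' Z) p := by
    refine hA.canonical_congr hY.diff (hA.smoothAt_canonical (hX.add hX') hZ).diff hY.diff
      (hXZ.add hXZ').diff (.of_forall fun _ ↦ rfl) ?_
    filter_upwards [hX.eventually_diff, hX'.eventually_diff, hZ.eventually_diff] with q h1 h2 h3
    exact hA.canonical_add_left h1 h2 h3
  rw [curvature, curvature, curvature, h1, hA.canonical_add_right hY.diff hXZ.diff hXZ'.diff,
    hA.canonical_add_left hX.diff hX'.diff (hA.smoothAt_canonical hY hZ).diff,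
    hA.canonical_congr_left ((hX.add hX').bracket hY).diff
    ((hX.bracket hY).add (hX'.bracket hY)).diff hZ.diff (bracket_add_left hX.diff hX'.diff),
    hA.canonical_add_left (hX.bracket hY).diff (hX'.bracket hY).diff hZ.diff]
  abel

theorem curvature_smul_left (hA : A.IsAlmostQuasiSasakian) (hf : SmoothFun m f p)
    (hX : SmoothAt X p) (hY : SmoothAt Y p) (hZ : SmoothAt Z p) :
    A.curvature (f • X) Y Z p = f p • A.curvature X Y Z p := by
  have hXZ := hA.smoothAt_canonical hX hZ
  have hd := (smoothFun_const (-1)).mul (A.smoothFun_dirDeriv hY hf)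
  have h1 : A.canonical Y (A.canonical (f • X) Z) p = A.canonical Y (f • A.canonical X Z) p := by
    refine hA.canonical_congr hY.diff (hA.smoothAt_canonical (.smul hf hX) hZ).diff hY.diff
      (SmoothAt.smul hf hXZ).diff (.of_forall fun _ ↦ rfl) ?_
    filter_upwards [hX.eventually_diff, hf.eventually_diff, hZ.eventually_diff] with q h1 h2 h3
    exact hA.canonical_smul_left h2 h1 h3
  have h2 : bracket (f • X) Y p
      = (((fun _ ↦ -1) * dirDeriv Y f) • X + f • bracket X Y) p := by
    rw [bracket_smul_left hf.diff hX.diff]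
    simp
  have h3 := SmoothAt.smul hd hX
  have h4 := SmoothAt.smul hf (hX.bracket hY)
  rw [curvature, curvature, h1, hA.canonical_smul_right hf.diff hY.diff hXZ.diff,
    hA.canonical_smul_left hf.diff hX.diff (hA.smoothAt_canonical hY hZ).diff,
    hA.canonical_congr_left (SmoothAt.bracket (.smul hf hX) hY).diff (h3.add h4).diff hZ.diff h2,
    hA.canonical_add_left h3.diff h4.diff hZ.diff, hA.canonical_smul_left hd.diff hX.diff hZ.diff,
    hA.canonical_smul_left hf.diff (hX.bracket hY).diff hZ.diff, Pi.mul_apply]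
  module

/-- `eq_zero_of_tensorial` applies to `X - X'`; it asks for linearity on smooth fields only, which
suits an operator containing second derivatives. -/
theorem curvature_eq_of_left_eq (hA : A.IsAlmostQuasiSasakian) (hX : SmoothAt X p)
    (hX' : SmoothAt X' p) (hY : SmoothAt Y p) (hZ : SmoothAt Z p) (h : X p = X' p) :
    A.curvature X Y Z p = A.curvature X' Y Z p := by
  have hn : SmoothAt ((fun _ : M ↦ (-1 : ℝ)) • X') p := .smul (smoothFun_const _) hX'
  have h0 := eq_zero_of_tensorial A (T := fun V ↦ A.curvature V Y Z p)
    (fun _ _ h1 h2 h3 ↦ hA.curvature_congr_left h1 h2 hY hZ h3)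
    (fun _ _ h1 h2 ↦ hA.curvature_add_left h1 h2 hY hZ)
    (fun _ _ h1 h2 ↦ hA.curvature_smul_left h1 h2 hY hZ) (hX.add hn) (by simp [h])
  rw [hA.curvature_add_left hX hn hY hZ, hA.curvature_smul_left (smoothFun_const _) hX' hY hZ]
    at h0
  simpa [add_neg_eq_zero] using h0

theorem curvature_projP_left (hA : A.IsAlmostQuasiSasakian) (hX : SmoothAt X p)
    (hY : SmoothAt Y p) (hZ : SmoothAt Z p) : A.curvature X Y Z p =
      A.curvature (A.projP X) Y Z p + A.eta X p • A.curvature A.ξ Y Z p := by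
  conv_lhs => rw [A.eq_projP_add X]
  rw [hA.curvature_add_left (A.smoothAt_projP hX) (.smul (A.smoothFun_eta hX) (A.smoothAt_ξ p))
    hY hZ, hA.curvature_smul_left (A.smoothFun_eta hX) (A.smoothAt_ξ p) hY hZ]

/-! ### Parallel torsion: the curvature vanishes on `ξ` -/

/-- `ψ` is `ω` with an index raised by the parallel metric, hence parallel together with `ω`. -/
theorem canonical_psi (hA : A.IsAlmostQuasiSasakian) (hpar : A.HasParallelTorsion)
    (hX : SmoothAt X p) (hY : SmoothAt Y p) :
    A.canonical X (A.psi Y) p = A.psi (A.canonical X Y) p := by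
  have hψ := A.smoothAt_psi hY
  refine A.eq_of_g_eq fun W hW ↦ ?_
  have h1 := hA.dirDeriv_metric_canonical hX.diff hψ.diff hW.diff
  have h2 := (hA.hasParallelTorsion_iff_nablaOmega.1 hpar) p X Y W hX hY hW
  have h3 : dirDeriv X (A.metric (A.psi Y) W) p = dirDeriv X (A.omega Y W) p := by
    refine dirDeriv_congr ?_
    filter_upwards [hW.eventually_diff] with q hq
    exact A.g_psi hq
  rw [nablaOmega, ← A.g_psi (hA.smoothAt_canonical hX hW).diff] at h2
  rw [A.g_psi hW.diff]
  linarith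

/-- The first Bianchi identity for `ξ, Y, Z`, where `K(Y, Z)ξ = 0` and the terms quadratic in the
torsion cancel because `ψ²` is symmetric. Here it is derived directly from `∇^N_ξ = L_ξ + 2ψ`, the
torsion formula, parallel `ψ` and the Jacobi identity. -/
theorem curvature_ξ_left_symm (hA : A.IsAlmostQuasiSasakian) (hpar : A.HasParallelTorsion)
    (hY : A.AdmissibleAt Y p) (hZ : A.AdmissibleAt Z p) :
    A.curvature A.ξ Y Z p = A.curvature A.ξ Z Y p := by
  have hξ := A.smoothAt_ξ p
  have hr {V : VF m M} : ∀ᶠ q in 𝓝 p, V q = V q := .of_forall fun _ ↦ rfl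
  have hbY := hA.admissibleAt_bracket_ξ hY
  have hbZ := hA.admissibleAt_bracket_ξ hZ
  have hYZ := hY.1.bracket hZ.1
  have hω := (smoothFun_const 2).mul (A.smoothFun_omega hY.1 hZ.1)
  have e1 : A.canonical A.ξ (A.canonical Y Z) p = A.canonical A.ξ (A.canonical Z Y
      + (bracket Y Z + ((fun _ ↦ 2) * A.omega Y Z) • A.ξ)) p := by
    refine hA.canonical_congr hξ.diff (hA.smoothAt_canonical hY.1 hZ.1).diff hξ.diff
      ((hA.smoothAt_canonical hZ.1 hY.1).add (hYZ.add (.smul hω hξ))).diff hr ?_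
    filter_upwards [hY.eventually, hZ.eventually] with q h1 h2
    rw [hA.canonical_torsion h1.1 h2.1, eta, eta, h1.2.self_of_nhds, h2.2.self_of_nhds]
    simp [add_assoc]
  have e2 {U V : VF m M} (hU : A.AdmissibleAt U p) (hV : A.AdmissibleAt V p) :
      A.canonical U (A.canonical A.ξ V) p
        = A.canonical U (bracket A.ξ V) p + (2 : ℝ) • A.psi (A.canonical U V) p := by
    have hψ := A.smoothAt_psi hV.1
    rw [hA.canonical_congr hU.1.diff (hA.smoothAt_canonical hξ hV.1).diff hU.1.diff
      (Y' := bracket A.ξ V + (fun _ : M ↦ (2 : ℝ)) • A.psi V)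
      ((hξ.bracket hV.1).add (.smul (smoothFun_const 2) hψ)).diff hr ?_,
      hA.canonical_add_right hU.1.diff (hξ.bracket hV.1).diff
        (SmoothAt.smul (smoothFun_const 2) hψ).diff,
      hA.canonical_smul_right (diffFun_const 2) hU.1.diff hψ.diff, hA.canonical_psi hpar hU.1 hV.1,
      dirDeriv_const]
    · simp
    · filter_upwards [hV.1.eventually_diff] with q hq
      exact hA.canonical_ξ_left hq
  have e3 {U V : VF m M} (hU : A.AdmissibleAt U p) (hV : A.AdmissibleAt V p) :
      A.canonical U V p = A.canonical V U p + bracket U V p + (2 * A.omega U V p) • A.ξ p := by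
    rw [hA.canonical_torsion hU.1.diff hV.1.diff, eta, eta, hU.2.self_of_nhds, hV.2.self_of_nhds]
    simp
  -- This is `L_ξ ω = 0`, recovered from `∇^N_ξ ω = 0`.
  have hL : dirDeriv A.ξ (A.omega Y Z) p
      = A.omega Y (bracket A.ξ Z) p - A.omega Z (bracket A.ξ Y) p := by
    have h := hA.nablaOmega_ξ_left hY hZ
    rw [hA.nablaOmega_eq hξ hY.1 hZ.1, hA.canonical_ξ_left hY.1.diff,
      hA.canonical_ξ_left hZ.1.diff, map_add, map_add, map_smul, map_smul,
      A.g_psi hbY.1.diff, A.g_psi hbZ.1.diff, A.g_symm p (A.psi Z p) (A.psi Y p)] at h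
    linarith
  -- On `D` the torsion is a multiple of `ξ`, which `ψ` kills.
  have hψ : A.psi (A.canonical Y Z) p = A.psi (A.canonical Z Y) p + A.psi (bracket Y Z) p := by
    have h1 := hA.smoothAt_canonical hZ.1 hY.1
    have h2 := SmoothAt.smul hω hξ
    rw [A.psi_congr_point (hA.smoothAt_canonical hY.1 hZ.1).diff (h1.add (hYZ.add h2)).diff
      (by rw [e3 hY hZ]; simp [add_assoc]), psi_add h1.diff (hYZ.add h2).diff,
      psi_add hYZ.diff h2.diff, psi_smul hω.diff hξ.diff, hA.psi_ξ, smul_zero, add_zero]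
  rw [curvature, curvature, e1, e2 hY hZ, e2 hZ hY,
    hA.canonical_add_right hξ.diff (hA.smoothAt_canonical hZ.1 hY.1).diff
      (hYZ.add (.smul hω hξ)).diff,
    hA.canonical_add_right hξ.diff hYZ.diff (SmoothAt.smul hω hξ).diff,
    hA.canonical_smul_right hω.diff hξ.diff hξ.diff, hA.canonical_ξ hξ.diff,
    dirDeriv_mul (diffFun_const 2) (A.smoothFun_omega hY.1 hZ.1).diff, dirDeriv_const, hL,
    hA.canonical_ξ_left hYZ.diff, bracket_jacobi hξ hY.1 hZ.1, e3 hY hbZ, e3 hZ hbY, hψ,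
    bracket_swap (X := bracket A.ξ Y)]
  module

/-- On `D` the form `g(K(ξ, Y)Z, W)` is symmetric in `Y, Z` and skew in `Z, W`. Alternating the two
symmetries three times gives the form equal to its own negative. -/
theorem curvature_ξ_left_admissible (hA : A.IsAlmostQuasiSasakian) (hpar : A.HasParallelTorsion)
    (hY : A.AdmissibleAt Y p) (hZ : A.AdmissibleAt Z p) : A.curvature A.ξ Y Z p = 0 := by
  have hξ := A.smoothAt_ξ p
  refine A.eq_of_g_eq fun W hW ↦ ?_
  have hP := A.admissibleAt_projP hW
  have e : A.g p (A.curvature A.ξ Y Z p) (W p)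
      = A.g p (A.curvature A.ξ Y Z p) (A.projP W p) := by
    rw [projP, map_sub, map_smul, A.g_ξ_right, hA.η_curvature hξ hY.1 hZ.1, smul_zero, sub_zero]
  have sk {U V V' : VF m M} (hU : A.AdmissibleAt U p) (hV : A.AdmissibleAt V p)
      (hV' : A.AdmissibleAt V' p) : A.g p (A.curvature A.ξ U V p) (V' p)
        = -A.g p (A.curvature A.ξ U V' p) (V p) := by
    rw [hA.g_curvature_skew hξ hU.1 hV.1 hV'.1, A.g_symm]
  have sy {U V : VF m M} (hU : A.AdmissibleAt U p) (hV : A.AdmissibleAt V p) :=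
    hA.curvature_ξ_left_symm hpar hU hV
  have h1 := sk hY hZ hP
  have h2 := sk hP hY hZ
  have h3 := sk hZ hY hP
  rw [sy hY hP] at h1
  rw [sy hP hZ] at h2
  rw [sy hZ hY] at h3
  rw [map_zero, _root_.zero_apply, e]
  linarith

theorem curvature_ξ_left (hA : A.IsAlmostQuasiSasakian) (hpar : A.HasParallelTorsion)
    (hY : SmoothAt Y p) (hZ : SmoothAt Z p) : A.curvature A.ξ Y Z p = 0 := by
  have hξ := A.smoothAt_ξ p
  have hself : A.curvature A.ξ A.ξ Z p = 0 := by
    have h := hA.curvature_swap hξ hξ hZ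
    rw [eq_neg_iff_add_eq_zero] at h
    have h2 : A.curvature A.ξ A.ξ Z p
        = (1 / 2 : ℝ) • (A.curvature A.ξ A.ξ Z p + A.curvature A.ξ A.ξ Z p) := by module
    rw [h2, h, smul_zero]
  rw [hA.curvature_swap hξ hY hZ, hA.curvature_projP_left hY hξ hZ, hself, smul_zero, add_zero,
    ← hA.curvature_projP_right (A.smoothAt_projP hY) hξ hZ,
    ← hA.curvature_swap hξ (A.smoothAt_projP hY) (A.smoothAt_projP hZ)]
  exact hA.curvature_ξ_left_admissible hpar (A.admissibleAt_projP hY) (A.admissibleAt_projP hZ)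

/-- Makes the trace over `T_p M` in `ricci` comparable with the trace over `D` in `ricciWagner`. -/
theorem curvature_projP_mid (hA : A.IsAlmostQuasiSasakian) (hpar : A.HasParallelTorsion)
    (hX : SmoothAt X p) (hY : SmoothAt Y p) (hZ : SmoothAt Z p) :
    A.curvature X (A.projP Y) Z p = A.curvature X Y Z p := by
  rw [hA.curvature_swap hX hY hZ, hA.curvature_projP_left hY hX hZ,
    hA.curvature_ξ_left hpar hX hZ, smul_zero, add_zero,
    ← hA.curvature_swap hX (A.smoothAt_projP hY) hZ]

/-! ### Comparison with the Schouten tensor, Ricci tensors -/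

/-- The second derivatives agree on `D`. For the `ξ`-part of `[X, Y]`, which is `-2ω(X, Y)ξ`, the
canonical curvature uses `[ξ, Z] + 2ψZ` and the Schouten tensor only `[ξ, Z]`. -/
theorem curvature_eq_schouten (hA : A.IsAlmostQuasiSasakian) (hX : A.AdmissibleAt X p)
    (hY : A.AdmissibleAt Y p) (hZ : A.AdmissibleAt Z p) :
    A.curvature X Y Z p = A.schouten X Y Z p + (4 * A.omega X Y p) • A.psi Z p := by
  have hξ := A.smoothAt_ξ p
  have hXY := hX.1.bracket hY.1
  have hP := A.admissibleAt_projP hXY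
  have hη := A.smoothFun_eta hXY
  have e1 {U V : VF m M} (hU : A.AdmissibleAt U p) (hV : A.AdmissibleAt V p) :
      A.interior U (A.interior V Z) p = A.canonical U (A.canonical V Z) p := by
    have hc := hA.admissibleAt_canonical hV.1 hZ
    have he := hA.interior_eventuallyEq_canonical hV hZ
    have hi : SmoothAt (A.interior V Z) p := hc.1.congr he
    rw [hA.interior_eq_canonical hU.1.diff hU.2.self_of_nhds hi.diff
      (he.mp (hc.2.mono fun q h1 h2 ↦ by rw [h2, h1])), hA.canonical_congr hU.1.diff hi.diff
      hU.1.diff hc.1.diff (.of_forall fun _ ↦ rfl) he]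
  have e2 : A.canonical (bracket X Y) Z p = A.canonical (A.projP (bracket X Y)) Z p
      + A.eta (bracket X Y) p • A.canonical A.ξ Z p := by
    conv_lhs => rw [A.eq_projP_add (bracket X Y)]
    rw [hA.canonical_add_left hP.1.diff (SmoothAt.smul hη hξ).diff hZ.1.diff,
      hA.canonical_smul_left hη.diff hξ.diff hZ.1.diff]
  -- The derivative of the coefficient multiplies `ξ` and is removed by `P`, while `[ξ, Z]` already
  -- lies in `D`.
  have e3 : A.projP (bracket (A.projQ (bracket X Y)) Z) p
      = A.eta (bracket X Y) p • bracket A.ξ Z p := by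
    rw [projP, projQ_eq, bracket_smul_left hη.diff hξ.diff, map_add, map_neg, map_smul, map_smul,
      A.η_ξ, (hA.admissibleAt_bracket_ξ hZ).2.self_of_nhds]
    simp only [smul_eq_mul]
    module
  have e4 : A.omega X Y p = -(1 / 2) * A.eta (bracket X Y) p := omega_of_eventually hX.2 hY.2
  rw [curvature, schouten, e1 hX hY, e1 hY hX, hA.interior_eq_canonical hP.1.diff
    hP.2.self_of_nhds hZ.1.diff hZ.2, e2, e3, e4, hA.canonical_ξ_left hZ.1.diff]
  module

/-- The correction is the trace of the rank-one map `Y ↦ 4g(ψX, Y)ψZ`, which is `4g(ψX, ψZ)`. -/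
theorem ricci_eq (hA : A.IsAlmostQuasiSasakian) (hpar : A.HasParallelTorsion)
    (hX : A.AdmissibleAt X p) (hZ : A.AdmissibleAt Z p) :
    A.ricci X Z p = A.ricciWagner X Z p + 4 * A.omega X (A.psi Z) p := by
  have h (i : Fin (2 * m + 1)) : A.curvature X (localFrame p i) Z p
      = A.schouten X (A.projP (localFrame p i)) Z p
        + (4 * A.g p (A.psi X p) (stdBasis p i)) • A.psi Z p := by
    have hs := smoothAt_localFrame p i
    rw [← hA.curvature_projP_mid hpar hX.1 hs hZ.1,
      hA.curvature_eq_schouten hX (A.admissibleAt_projP hs) hZ,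
      ← A.g_psi (A.smoothAt_projP hs).diff, projP, hA.g_psi_sub_smul_ξ hX.1.diff,
      localFrame_self]
  rw [ricci, ricciWagner, traceAt, traceAt, ← A.g_psi (A.smoothAt_psi hZ.1).diff]
  simp only [h, map_add, map_smul, Finsupp.add_apply, Finsupp.smul_apply, smul_eq_mul,
    Finset.sum_add_distrib]
  congr 1
  conv_rhs => rw [← (stdBasis p).sum_repr (A.psi Z p), map_sum, Finset.mul_sum]
  refine Finset.sum_congr rfl fun i _ ↦ ?_
  rw [map_smul, smul_eq_mul]
  ring

theorem ricci_ξ_right (hA : A.IsAlmostQuasiSasakian) (hX : SmoothAt X p) :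
    A.ricci X A.ξ p = 0 := by
  simp [ricci, traceAt, hA.curvature_ξ hX (smoothAt_localFrame p _)]

theorem ricci_ξ_left (hA : A.IsAlmostQuasiSasakian) (hpar : A.HasParallelTorsion)
    (hX : SmoothAt X p) : A.ricci A.ξ X p = 0 := by
  simp [ricci, traceAt, hA.curvature_ξ_left hpar (smoothAt_localFrame p _) hX]

theorem ricci_projP (hA : A.IsAlmostQuasiSasakian) (hpar : A.HasParallelTorsion)
    (hX : SmoothAt X p) (hZ : SmoothAt Z p) :
    A.ricci (A.projP X) (A.projP Z) p = A.ricci X Z p := by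
  rw [ricci, ricci, traceAt, traceAt]
  refine Finset.sum_congr rfl fun i _ ↦ ?_
  have hs := smoothAt_localFrame p i
  rw [hA.curvature_projP_right (A.smoothAt_projP hX) hs hZ, hA.curvature_projP_left hX hs hZ,
    hA.curvature_ξ_left hpar hs hZ, smul_zero, add_zero]

/-- Evaluation on `(ξ, ξ)`, where the Ricci tensor is `0` and the metric is `1`, forces the constant
to vanish. -/
theorem isEinstein_iff_ricci (hA : A.IsAlmostQuasiSasakian) (hpar : A.HasParallelTorsion) :
    A.IsEinstein ↔ ∀ p X Z, SmoothAt X p → SmoothAt Z p → A.ricci X Z p = 0 := by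
  constructor
  · rintro ⟨c, hc⟩ p X Z hX hZ
    have h := hc p A.ξ A.ξ (A.smoothAt_ξ p) (A.smoothAt_ξ p)
    rw [hA.ricci_ξ_left hpar (A.smoothAt_ξ p), metric, A.g_ξ_left, A.η_ξ, mul_one] at h
    rw [hc p X Z hX hZ, ← h, zero_mul]
  · intro h
    exact ⟨0, fun p X Z hX hZ ↦ by rw [h p X Z hX hZ, zero_mul]⟩

theorem isEinstein_iff (hA : A.IsAlmostQuasiSasakian) (hpar : A.HasParallelTorsion) :
    A.IsEinstein ↔ ∀ p X Z, A.AdmissibleAt X p → A.AdmissibleAt Z p →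
      A.ricciWagner X Z p = 4 * A.omega (A.psi Z) X p := by
  rw [hA.isEinstein_iff_ricci hpar]
  constructor
  · intro h p X Z hX hZ
    have h1 := hA.ricci_eq hpar hX hZ
    rw [h p X Z hX.1 hZ.1, A.omega_swap] at h1
    linarith
  · intro h p X Z hX hZ
    have hPX := A.admissibleAt_projP hX
    have hPZ := A.admissibleAt_projP hZ
    rw [← hA.ricci_projP hpar hX hZ, hA.ricci_eq hpar hPX hPZ, h p _ _ hPX hPZ, A.omega_swap]
    ring

end IsAlmostQuasiSasakian

end AlmostContactMetric

namespace AlmostContactMetric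

variable {m : ℕ} {M : Type*} [TopologicalSpace M] [ChartedSpace (Model m) M]
  [IsManifold (𝓡 (2 * m + 1)) ∞ M] {A : AlmostContactMetric m M}
  {X Z : VF m M} {p : M} {c : OpenPartialHomeomorph M (Model m)}

/-! ### Adapted charts -/

theorem contMDiffAt_const_vectorField {E : Type*} [NormedAddCommGroup E] [NormedSpace ℝ E]
    {V : (x : E) → TangentSpace 𝓘(ℝ, E) x} {v : E} (hV : ∀ x, V x = v) (x : E) :
    ContMDiffAt 𝓘(ℝ, E) 𝓘(ℝ, E).tangent ∞ (fun y ↦ (⟨y, V y⟩ : TangentBundle 𝓘(ℝ, E) E)) x := by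
  rw [contMDiffAt_vectorSpace_iff_contDiffAt]
  have : V = fun _ ↦ v := funext hV
  exact this ▸ contDiffAt_const

theorem exists_equiv_mfderiv (hc : c ∈ IsManifold.maximalAtlas (𝓡 (2 * m + 1)) ∞ M)
    (hp : p ∈ c.source) : ∃ e : TangentSpace (𝓡 (2 * m + 1)) p ≃L[ℝ]
      TangentSpace 𝓘(ℝ, Model m) (c p), mfderiv (𝓡 (2 * m + 1)) 𝓘(ℝ, Model m) c p = e := by
  have h : c.MDifferentiable (𝓡 (2 * m + 1)) 𝓘(ℝ, Model m) :=
    ⟨fun q hq ↦ ((contMDiffAt_of_mem_maximalAtlas hc hq).mdifferentiableAt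
        (by simp)).mdifferentiableWithinAt,
      fun q hq ↦ ((contMDiffAt_symm_of_mem_maximalAtlas hc hq).mdifferentiableAt
        (by simp)).mdifferentiableWithinAt⟩
  exact ⟨h.mfderiv hp, rfl⟩

theorem smoothAt_coordField (hc : c ∈ IsManifold.maximalAtlas (𝓡 (2 * m + 1)) ∞ M)
    (hp : p ∈ c.source) (i : Fin (2 * m + 1)) : SmoothAt (coordField c i) p := by
  obtain ⟨e, he⟩ := exists_equiv_mfderiv hc hp
  have : IsManifold (𝓡 (2 * m + 1)) (((⊤ : ℕ∞) : WithTop ℕ∞) + 1) M := by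
    simpa using! (inferInstance : IsManifold (𝓡 (2 * m + 1)) ∞ M)
  have h1 := isManifold_of_smooth (m := m) (M := M) 1
  have hV := contMDiffAt_const_vectorField (V := fun _ : Model m ↦ EuclideanSpace.single i (1 : ℝ))
    (fun _ ↦ rfl) (c p)
  exact ContMDiffAt.mpullback_vectorField_preimage hV (contMDiffAt_of_mem_maximalAtlas hc hp)
    ⟨e, he.symm⟩ (by simp)

theorem exists_basis_coordField (hc : c ∈ IsManifold.maximalAtlas (𝓡 (2 * m + 1)) ∞ M)
    (hp : p ∈ c.source) :
    ∃ b : Module.Basis (Fin (2 * m + 1)) ℝ (TangentSpace (𝓡 (2 * m + 1)) p),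
      ∀ i, b i = coordField c i p := by
  obtain ⟨e, he⟩ := exists_equiv_mfderiv hc hp
  refine ⟨(EuclideanSpace.basisFun (Fin (2 * m + 1)) ℝ).toBasis.map e.symm.toLinearEquiv,
    fun i ↦ ?_⟩
  have h : coordField c i p = (mfderiv (𝓡 (2 * m + 1)) 𝓘(ℝ, Model m) c p).inverse
      (EuclideanSpace.single i (1 : ℝ) : Model m) := rfl
  have hi : (EuclideanSpace.basisFun (Fin (2 * m + 1)) ℝ).toBasis i
      = EuclideanSpace.single i (1 : ℝ) := by simp
  rw [h, he, ContinuousLinearMap.inverse_equiv]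
  exact congrArg e.symm hi

theorem admissibleAt_adaptedFrame (A : AlmostContactMetric m M)
    (hc : c ∈ IsManifold.maximalAtlas (𝓡 (2 * m + 1)) ∞ M) (hp : p ∈ c.source)
    (a : Fin (2 * m)) : A.AdmissibleAt (A.adaptedFrame c a) p :=
  A.admissibleAt_projP (smoothAt_coordField hc hp _)

/-- The frame `e_1, …, e_2m, ξ` of an adapted chart. -/
theorem IsAdapted.exists_basis (hc : A.IsAdapted c) (hp : p ∈ c.source) :
    ∃ b : Module.Basis (Fin (2 * m + 1)) ℝ (TangentSpace (𝓡 (2 * m + 1)) p),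
      (∀ a : Fin (2 * m), b a.castSucc = A.adaptedFrame c a p) ∧ b (Fin.last _) = A.ξ p := by
  obtain ⟨b, hb⟩ := exists_basis_coordField hc.1 hp
  have hξ := hc.2 p hp
  set v : Fin (2 * m + 1) → TangentSpace (𝓡 (2 * m + 1)) p :=
    Fin.snoc (α := fun _ ↦ TangentSpace (𝓡 (2 * m + 1)) p)
      (fun a ↦ A.adaptedFrame c a p) (A.ξ p) with hv
  have hspan : ⊤ ≤ Submodule.span ℝ (Set.range v) := by
    rw [← b.span_eq, Submodule.span_le]
    have hl : A.ξ p ∈ Submodule.span ℝ (Set.range v) :=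
      Submodule.subset_span ⟨Fin.last _, by simp [hv]⟩
    rintro _ ⟨i, rfl⟩
    rw [hb]
    refine Fin.lastCases ?_ (fun a ↦ ?_) i
    · rw [hξ]
      exact hl
    · have ha : A.adaptedFrame c a p ∈ Submodule.span ℝ (Set.range v) :=
        Submodule.subset_span ⟨a.castSucc, by simp [hv]⟩
      -- `∂_a = e_a + η(∂_a)ξ`, so replacing `∂_a` by `e_a` does not shrink the span.
      have := Submodule.add_mem _ ha
        (Submodule.smul_mem _ (A.η p (coordField c a.castSucc p)) hl)
      simpa [adaptedFrame, projP] using this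
  refine ⟨basisOfTopLeSpanOfCardEqFinrank v hspan (by simp [finrank_tangentSpace]),
    fun a ↦ ?_, ?_⟩ <;> simp [hv]

theorem IsAdapted.eq_of_g_eq (hc : A.IsAdapted c) (hp : p ∈ c.source)
    {u v : TangentSpace (𝓡 (2 * m + 1)) p} (hη : A.η p u = A.η p v)
    (h : ∀ a, A.g p u (A.adaptedFrame c a p) = A.g p v (A.adaptedFrame c a p)) : u = v := by
  obtain ⟨b, hb, hbξ⟩ := hc.exists_basis hp
  rw [← sub_eq_zero]
  refine A.g_nondegenerate p _ fun w ↦ ?_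
  rw [← b.sum_repr w, map_sum]
  refine Finset.sum_eq_zero fun i _ ↦ ?_
  rw [map_smul]
  refine smul_eq_zero_of_right _ ?_
  refine Fin.lastCases ?_ (fun a ↦ ?_) i
  · rw [hbξ, A.g_ξ_right, map_sub, hη, sub_self]
  · rw [hb, map_sub, _root_.sub_apply, h, sub_self]

theorem η_adaptedFrame (A : AlmostContactMetric m M) (a : Fin (2 * m)) :
    A.η p (A.adaptedFrame c a p) = 0 := A.η_projP _ _

theorem IsAdapted.isUnit_frameGram (hc : A.IsAdapted c) (hp : p ∈ c.source) :
    IsUnit (A.frameGram (A.adaptedFrame c) p).det := by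
  obtain ⟨b, hb, -⟩ := hc.exists_basis hp
  refine A.isUnit_frameGram_det ?_ fun k hk ↦ hc.eq_of_g_eq hp ?_ fun a ↦ ?_
  · simpa only [← hb] using! b.linearIndependent.comp _ (Fin.castSucc_injective (2 * m))
  · simp [η_adaptedFrame]
  · rw [hk, map_zero, _root_.zero_apply]

namespace IsAlmostQuasiSasakian

/-- Both sides lie in `D` and have the same products with the `e_a`, so `psiComp` is indeed the
matrix of `ψ` on `D`. -/
theorem psi_adaptedFrame (hA : A.IsAlmostQuasiSasakian) (hc : A.IsAdapted c)
    (hp : p ∈ c.source) (b : Fin (2 * m)) :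
    A.psi (A.adaptedFrame c b) p = ∑ d, A.psiComp c p d b • A.adaptedFrame c d p := by
  have hs (a) := (A.admissibleAt_adaptedFrame hc.1 hp a).1.diff
  refine hc.eq_of_g_eq hp ?_ fun a ↦ ?_
  · rw [hA.η_psi (hs b)]
    simp [η_adaptedFrame]
  · rw [A.g_psi (hs a)]
    exact (A.g_sum_inv_frameGram (hc.isUnit_frameGram hp) (fun d ↦ A.omegaComp c p b d) a).symm

theorem sum_omegaComp_mul_psiComp (hA : A.IsAlmostQuasiSasakian) (hc : A.IsAdapted c)
    (hp : p ∈ c.source) (a b : Fin (2 * m)) :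
    ∑ d, A.omegaComp c p a d * A.psiComp c p d b
      = A.omega (A.adaptedFrame c a) (A.psi (A.adaptedFrame c b)) p := by
  have hs (a) := (A.admissibleAt_adaptedFrame hc.1 hp a).1
  rw [← A.g_psi (A.smoothAt_psi (hs b)).diff, hA.psi_adaptedFrame hc hp b, map_sum]
  refine Finset.sum_congr rfl fun d _ ↦ ?_
  rw [map_smul, A.g_psi (hs d).diff, smul_eq_mul, mul_comm, omegaComp]

theorem sum_omegaComp_swap_mul_psiComp (hA : A.IsAlmostQuasiSasakian) (hc : A.IsAdapted c)
    (hp : p ∈ c.source) (a b : Fin (2 * m)) :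
    ∑ d, A.omegaComp c p d a * A.psiComp c p d b
      = A.omega (A.psi (A.adaptedFrame c b)) (A.adaptedFrame c a) p := by
  rw [A.omega_swap, ← hA.sum_omegaComp_mul_psiComp hc hp, ← Finset.sum_neg_distrib]
  refine Finset.sum_congr rfl fun d _ ↦ ?_
  rw [omegaComp, A.omega_swap, neg_mul, omegaComp]

/-- The Ricci tensor at a point as a bilinear form. -/
theorem exists_ricci_bilin (hA : A.IsAlmostQuasiSasakian) (p : M) :
    ∃ B : TangentSpace (𝓡 (2 * m + 1)) p →ₗ[ℝ] TangentSpace (𝓡 (2 * m + 1)) p →ₗ[ℝ] ℝ,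
      ∀ X Z : VF m M, SmoothAt X p → SmoothAt Z p → A.ricci X Z p = B (X p) (Z p) := by
  have hs := smoothAt_extendVF (m := m) (p := p)
  have hl (i) := smoothAt_localFrame (m := m) p i
  have hk (r : ℝ) := smoothFun_const (m := m) (p := p) r
  have hcongr {X X' Z Z' : VF m M} (hX : SmoothAt X p) (hX' : SmoothAt X' p) (hZ : SmoothAt Z p)
      (hZ' : SmoothAt Z' p) (h : X p = X' p) (h' : Z p = Z' p) :
      A.ricci X Z p = A.ricci X' Z' p := by
    simp only [ricci, traceAt, hA.curvature_eq_of_left_eq hX hX' (hl _) hZ h,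
      hA.curvature_congr_right hX' (hl _) hZ hZ' h']
  refine ⟨LinearMap.mk₂ ℝ (fun u v ↦ A.ricci (extendVF u) (extendVF v) p) (fun u u' v ↦ ?_)
    (fun r u v ↦ ?_) (fun u v v' ↦ ?_) (fun r u v ↦ ?_), fun X Z hX hZ ↦ ?_⟩
  · rw [hcongr (hs _) ((hs u).add (hs u')) (hs v) (hs v) (by simp) rfl]
    simp [ricci, traceAt, hA.curvature_add_left (hs u) (hs u') (hl _) (hs v),
      Finset.sum_add_distrib]
  · rw [hcongr (hs _) (.smul (hk r) (hs u)) (hs v) (hs v) (by simp) rfl]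
    simp [ricci, traceAt, hA.curvature_smul_left (hk r) (hs u) (hl _) (hs v), Finset.mul_sum]
  · rw [hcongr (hs u) (hs u) (hs _) ((hs v).add (hs v')) rfl (by simp)]
    simp [ricci, traceAt, hA.curvature_add_right (hs u) (hl _) (hs v) (hs v'),
      Finset.sum_add_distrib]
  · rw [hcongr (hs u) (hs u) (hs _) (.smul (hk r) (hs v)) rfl (by simp)]
    simp [ricci, traceAt, hA.curvature_smul_right (hs u) (hl _) (hk r) (hs v), Finset.mul_sum]
  · exact hcongr hX (hs _) hZ (hs _) (by simp) (by simp)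

/-- The Ricci tensor is bilinear at `p`, and its entries involving `ξ` vanish anyway, so the entries
on the `e_a` decide. -/
theorem ricci_eq_zero_of_adaptedFrame (hA : A.IsAlmostQuasiSasakian)
    (hpar : A.HasParallelTorsion) (hc : A.IsAdapted c) (hp : p ∈ c.source)
    (h : ∀ a b, A.ricci (A.adaptedFrame c a) (A.adaptedFrame c b) p = 0)
    (hX : SmoothAt X p) (hZ : SmoothAt Z p) : A.ricci X Z p = 0 := by
  obtain ⟨B, hB⟩ := hA.exists_ricci_bilin p
  obtain ⟨b, hb, hbξ⟩ := hc.exists_basis hp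
  have hs (a) := (A.admissibleAt_adaptedFrame hc.1 hp a).1
  have hξ := A.smoothAt_ξ p
  suffices hB0 : B = 0 by rw [hB X Z hX hZ, hB0]; rfl
  refine b.ext fun i ↦ b.ext fun j ↦ ?_
  rw [LinearMap.zero_apply, LinearMap.zero_apply]
  refine Fin.lastCases ?_ (fun a ↦ ?_) i
  · refine Fin.lastCases ?_ (fun a ↦ ?_) j
    · rw [hbξ, ← hB _ _ hξ hξ, hA.ricci_ξ_right hξ]
    · rw [hbξ, hb, ← hB _ _ hξ (hs a), hA.ricci_ξ_left hpar (hs a)]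
  · refine Fin.lastCases ?_ (fun a' ↦ ?_) j
    · rw [hbξ, hb, ← hB _ _ (hs a) hξ, hA.ricci_ξ_right (hs a)]
    · rw [hb, hb, ← hB _ _ (hs a) (hs a'), h]

theorem ricci_adaptedFrame (hA : A.IsAlmostQuasiSasakian) (hpar : A.HasParallelTorsion)
    (hc : A.IsAdapted c) (hp : p ∈ c.source) (a b : Fin (2 * m)) :
    A.ricci (A.adaptedFrame c a) (A.adaptedFrame c b) p =
      A.ricciWagnerComp c p a b + 4 * ∑ d, A.omegaComp c p a d * A.psiComp c p d b := by
  rw [hA.sum_omegaComp_mul_psiComp hc hp, hA.ricci_eq hpar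
    (A.admissibleAt_adaptedFrame hc.1 hp a) (A.admissibleAt_adaptedFrame hc.1 hp b),
    ricciWagnerComp]

theorem isEinstein_iff_adaptedCharts (hA : A.IsAlmostQuasiSasakian)
    (hpar : A.HasParallelTorsion) {atl : Set (OpenPartialHomeomorph M (Model m))}
    (hatl : ∀ c ∈ atl, A.IsAdapted c) (hcover : ∀ p, ∃ c ∈ atl, p ∈ c.source) :
    A.IsEinstein ↔ ∀ c ∈ atl, ∀ p ∈ c.source, ∀ a b,
      A.ricciWagnerComp c p a b = 4 * ∑ d, A.omegaComp c p d a * A.psiComp c p d b := by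
  constructor
  · intro h c hc p hp a b
    rw [hA.sum_omegaComp_swap_mul_psiComp (hatl c hc) hp]
    exact (hA.isEinstein_iff hpar).1 h p _ _
      (A.admissibleAt_adaptedFrame (hatl c hc).1 hp a)
      (A.admissibleAt_adaptedFrame (hatl c hc).1 hp b)
  · intro h
    refine (hA.isEinstein_iff_ricci hpar).2 fun p X Z hX hZ ↦ ?_
    obtain ⟨c, hc, hp⟩ := hcover p
    have hc' := hatl c hc
    refine hA.ricci_eq_zero_of_adaptedFrame hpar hc' hp (fun a b ↦ ?_) hX hZ
    rw [hA.ricci_adaptedFrame hpar hc' hp, h c hc p hp, hA.sum_omegaComp_swap_mul_psiComp hc' hp,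
      hA.sum_omegaComp_mul_psiComp hc' hp, A.omega_swap]
    ring

end IsAlmostQuasiSasakian

end AlmostContactMetric

end

theorem theorem2 {m : ℕ} {M : Type*} [TopologicalSpace M] [ChartedSpace (Model m) M]
    [IsManifold (𝓡 (2 * m + 1)) ∞ M] (A : AlmostContactMetric m M)
    (hA : A.IsAlmostQuasiSasakian) :
    (A.HasParallelTorsion ↔ A.IsOmegaParallel) ∧
    (A.HasParallelTorsion →
      -- the Ricci tensor of the canonical connection
      (∀ p X Z, A.AdmissibleAt X p → A.AdmissibleAt Z p →
        A.ricci X Z p = A.ricciWagner X Z p + 4 * A.omega X (A.psi Z) p) ∧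
      (∀ p X, SmoothAt X p → A.ricci X A.ξ p = 0 ∧ A.ricci A.ξ X p = 0) ∧
      -- the criterion, free of coordinates
      (A.IsEinstein ↔ ∀ p X Z, A.AdmissibleAt X p → A.AdmissibleAt Z p →
        A.ricciWagner X Z p = 4 * A.omega (A.psi Z) X p) ∧
      -- the Ricci tensor in adapted coordinates
      (∀ c, A.IsAdapted c → ∀ p ∈ c.source,
        (∀ a b, A.ricci (A.adaptedFrame c a) (A.adaptedFrame c b) p =
          A.ricciWagnerComp c p a b + 4 * ∑ d, A.omegaComp c p a d * A.psiComp c p d b) ∧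
        (∀ a, A.ricci (A.adaptedFrame c a) A.ξ p = 0 ∧
          A.ricci A.ξ (A.adaptedFrame c a) p = 0) ∧
        A.ricci A.ξ A.ξ p = 0) ∧
      -- the criterion in adapted coordinates, for any atlas of adapted charts
      (∀ atl : Set (OpenPartialHomeomorph M (Model m)), (∀ c ∈ atl, A.IsAdapted c) →
        (∀ p, ∃ c ∈ atl, p ∈ c.source) →
        (A.IsEinstein ↔ ∀ c ∈ atl, ∀ p ∈ c.source, ∀ a b,
          A.ricciWagnerComp c p a b = 4 * ∑ d, A.omegaComp c p d a * A.psiComp c p d b))) := by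
  refine ⟨hA.hasParallelTorsion_iff, fun hpar ↦ ⟨fun p X Z ↦ hA.ricci_eq hpar, fun p X hX ↦
    ⟨hA.ricci_ξ_right hX, hA.ricci_ξ_left hpar hX⟩, hA.isEinstein_iff hpar, fun c hc p hp ↦
    ⟨hA.ricci_adaptedFrame hpar hc hp, fun a ↦ ?_, hA.ricci_ξ_right (A.smoothAt_ξ p)⟩,
    fun atl ↦ hA.isEinstein_iff_adaptedCharts hpar⟩⟩
  have h := (A.admissibleAt_adaptedFrame hc.1 hp a).1
  exact ⟨hA.ricci_ξ_right h, hA.ricci_ξ_left hpar h⟩
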